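/- Let $F$ be a field of characteristic $p$, where $p$ is a prime or $p=\infty$ (the latter meaning characteristic zero), and let $n\ge s\ge 1$ be integers. **Notation.** For $m\ge 0$ let $D_m(F)$ be the descent algebra of the symmetric group $\mathfrak S_m$ (permutations being composed from left to right): the subalgebra of $F\mathfrak S_m$ spanned by the elements $\Xi^q$, $q$ a composition of $m$, where $\Xi^q$ is the sum of the minimal-length representatives of the right cosets in $\mathfrak S_m$ of the Young subgroup $\mathfrak S_q$. A partition is $p$-regular if no part occurs $p$ or more times (every partition is $\infty$-regular). Two partitions $\lambda,\mu$ of $m$ are $p$-equivalent, $\lambda\sim_p\mu$, if the $p'$-parts of permutations of cycle types $\lambda$ and $\mu$ are conjugate in $\mathfrak S_m$ (for $p=\infty$ the $p'$-part of a permutation is the permutation itself). For a $p$-regular partition $\lambda$ of $m$ let $M_\lambda$ be the one-dimensional left $D_m(F)$-module on which each $\Xi^q$ acts as the scalar $\varphi^q(\lambda)\cdot 1_F$, where $\varphi^q(\lambda)$ is the number of right cosets of $\mathfrak S_q$ in $\mathfrak S_m$ fixed by a permutation of cycle type $\lambda$. The Ext quiver $Q_{m,p}$ of $D_m(F)$ has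 as vertices the $p$-regular partitions of $m$ and has $\dim_F\operatorname{Ext}^1_{D_m(F)}(M_\lambda,M_\mu)$ arrows from $\lambda$ to $\mu$. For a $p$-regular partition $\mu$ of $n-s$ let $\mu^{\#s}$ be the unique $p$-regular partition of $n$ that is $p$-equivalent to the partition obtained from $\mu$ by adding one part equal to $s$. **Theorem.** The Ext quiver $Q_{n-s,p}$ of $D_{n-s}(F)$ is a subquiver of the Ext quiver $Q_{n,p}$ of $D_n(F)$, via the identification of the vertex $\mu$ of $Q_{n-s,p}$ with the vertex $\mu^{\#s}$ of $Q_{n,p}$. That is, the map $\mu\mapsto\mu^{\#s}$ is well defined and injective on vertices, and it extends to a morphism of quivers $Q_{n-s,p}\to Q_{n,p}$ that is injective on arrows. -/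

import Mathlib

/-!
Descent algebras of the symmetric groups, their simple modules and their Ext quivers.

Conventions.  Permutations are multiplied from left to right: the group is `(Perm (Fin n))ᵐᵒᵖ`,
where `op σ * op τ = op (τ * σ) = op (τ ∘ σ)`.  Consequently a right coset of a Young subgroup for
the left-to-right product is a left coset `σ * Y = {σ ∘ h | h ∈ Y}` for the product of
`Perm (Fin n)`.  Modules are left modules.  The characteristic is a natural number `p`, with
`p = 0` for characteristic zero (often written `p = ∞` in modular representation theory).
-/

namespace Descent

open Equiv

variable {n : ℕ}

/-- The Young subgroup of a composition `q` of `n`: the permutations that preserve each of the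
consecutive intervals of sizes `q₁, q₂, …` (`q.index i` is the number of the interval that
contains `i`). -/

def youngSubgroup (q : Composition n) : Subgroup (Perm (Fin n)) where
  carrier := {h | ∀ i, q.index (h i) = q.index i}
  one_mem' := by simp
  mul_mem' := by
    intro a b ha hb i
    rw [Perm.mul_apply, ha, hb]
  inv_mem' := by
    intro a ha i
    have := ha (a⁻¹ i)
    simpa using this.symm

/-- The (Coxeter) length of a permutation: its number of inversions. -/
noncomputable def inversions (σ : Perm (Fin n)) : ℕ :=
  Nat.card {x : Fin n × Fin n // x.1 < x.2 ∧ σ x.2 < σ x.1}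

open Classical in
/-- The representatives of minimal length of the cosets `σ * youngSubgroup q`. -/
noncomputable def minCosetReps (q : Composition n) : Finset (Perm (Fin n)) :=
  {σ | ∀ h ∈ youngSubgroup q, inversions σ ≤ inversions (σ * h)}

theorem index_mono (q : Composition n) : Monotone q.index := by
  intro i j hij
  by_contra! h
  have h1 := q.sizeUpTo_index_le i
  have h2 := q.lt_sizeUpTo_index_succ j
  have h3 : q.sizeUpTo (q.index j).succ ≤ q.sizeUpTo (q.index i) :=
    q.monotone_sizeUpTo (by simpa using h)
  have : (i : ℕ) ≤ j := hij
  omega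

open Classical in
theorem inversions_eq (q : Composition n) (σ : Perm (Fin n)) :
    inversions σ =
      Nat.card {x : Fin n × Fin n // q.index x.1 < q.index x.2 ∧ σ x.2 < σ x.1} +
      Nat.card {x : Fin n × Fin n //
        (x.1 < x.2 ∧ q.index x.1 = q.index x.2) ∧ σ x.2 < σ x.1} := by
  unfold inversions
  simp only [Nat.card_eq_fintype_card, Fintype.card_subtype]
  rw [← Finset.card_union_of_disjoint]
  · congr 1
    ext x
    simp only [Finset.mem_filter, Finset.mem_univ, true_and, Finset.mem_union]
    constructor
    · rintro ⟨h1, h2⟩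
      rcases (index_mono q h1.le).lt_or_eq with h | h
      · exact Or.inl ⟨h, h2⟩
      · exact Or.inr ⟨⟨h1, h⟩, h2⟩
    · rintro (⟨h1, h2⟩ | ⟨⟨h1, -⟩, h2⟩)
      · exact ⟨(index_mono q).reflect_lt h1, h2⟩
      · exact ⟨h1, h2⟩
  · rw [Finset.disjoint_filter]
    rintro x - ⟨h1, -⟩ ⟨⟨-, h2⟩, -⟩
    exact h1.ne h2

theorem cross_eq (q : Composition n) (σ h : Perm (Fin n)) (hh : h ∈ youngSubgroup q) :
    Nat.card {x : Fin n × Fin n // q.index x.1 < q.index x.2 ∧ (σ * h) x.2 < (σ * h) x.1} =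
      Nat.card {x : Fin n × Fin n // q.index x.1 < q.index x.2 ∧ σ x.2 < σ x.1} := by
  refine Nat.card_congr ((h.prodCongr h).subtypeEquiv ?_)
  intro x
  have h1 := hh x.1
  have h2 := hh x.2
  simp [h1, h2]

theorem sort_comp_eq {α : Type*} [LinearOrder α] {f : Fin n → α} (hf : Monotone f)
    (τ : Perm (Fin n)) : (f ∘ τ) ∘ Tuple.sort (f ∘ τ) = f := by
  have h1 := Tuple.monotone_sort (f ∘ τ)
  have h2 : Monotone (f ∘ (1 : Perm (Fin n))) := by simpa using hf
  have := Tuple.unique_monotone (f := f) (σ := τ * Tuple.sort (f ∘ τ)) (τ := 1) h1 h2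
  simpa [Function.comp_assoc] using this

/-- The minimal coset representatives are the permutations increasing on each block of `q`. -/
theorem mem_minCosetReps {q : Composition n} {σ : Perm (Fin n)} :
    σ ∈ minCosetReps q ↔ ∀ i j, i < j → q.index i = q.index j → σ i < σ j := by
  simp only [minCosetReps, Finset.mem_filter, Finset.mem_univ, true_and]
  constructor
  · intro hmin i j hij hq
    set τ := Tuple.sort (q.index ∘ (σ⁻¹ : Perm (Fin n))) with hτ
    have hs : (q.index ∘ (σ⁻¹ : Perm (Fin n))) ∘ τ = q.index :=
      sort_comp_eq (index_mono q) σ⁻¹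
    have hinc := (Tuple.eq_sort_iff.1 hτ).2
    have hmem : σ⁻¹ * τ ∈ youngSubgroup q := fun i => congrFun hs i
    have := hmin _ hmem
    rw [inversions_eq q, inversions_eq q (σ * _), cross_eq q σ _ hmem] at this
    have h0 : Nat.card {x : Fin n × Fin n //
        (x.1 < x.2 ∧ q.index x.1 = q.index x.2) ∧
          (σ * (σ⁻¹ * τ)) x.2 < (σ * (σ⁻¹ * τ)) x.1} = 0 := by
      rw [Finite.card_eq_zero_iff, isEmpty_subtype]
      rintro x ⟨⟨h1, h2⟩, h3⟩
      have := hinc x.1 x.2 h1 (by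
        have a := congrFun hs x.1
        have b := congrFun hs x.2
        simp only [Function.comp_apply] at a b ⊢
        rw [a, b, h2])
      simp only [mul_inv_cancel_left] at h3
      exact absurd h3 this.not_gt
    rw [h0] at this
    have h0' : Nat.card {x : Fin n × Fin n //
        (x.1 < x.2 ∧ q.index x.1 = q.index x.2) ∧ σ x.2 < σ x.1} = 0 := by omega
    rw [Finite.card_eq_zero_iff, isEmpty_subtype] at h0'
    have := h0' (i, j)
    simp only [hij, hq, and_self, true_and, not_lt] at this
    exact lt_of_le_of_ne this (fun h => hij.ne (σ.injective h))
  · intro hinc h hh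
    rw [inversions_eq q, inversions_eq q (σ * h), cross_eq q σ _ hh]
    have h0 : Nat.card {x : Fin n × Fin n //
        (x.1 < x.2 ∧ q.index x.1 = q.index x.2) ∧ σ x.2 < σ x.1} = 0 := by
      rw [Finite.card_eq_zero_iff, isEmpty_subtype]
      rintro x ⟨⟨h1, h2⟩, h3⟩
      exact absurd h3 (hinc _ _ h1 h2).not_gt
    omega

/-- The level sets of a monotone word are the blocks of a composition. -/
theorem exists_composition {α : Type*} [LinearOrder α] {f : Fin n → α} (hf : Monotone f) :
    ∃ c : Composition n, ∀ i j, c.index i = c.index j ↔ f i = f j := by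
  classical
  let I := Finset.univ.image f
  let e : I ≃o Fin I.card := (I.orderIsoOfFin rfl).symm
  let h : Fin n → Fin I.card := fun i => e ⟨f i, Finset.mem_image_of_mem _ (Finset.mem_univ _)⟩
  have hmono : Monotone h := fun i j hij => e.monotone (hf hij)
  have hinj : ∀ i j, h i = h j ↔ f i = f j := by simp [h]
  have hsurj : Function.Surjective h := by
    intro k
    obtain ⟨⟨x, hx⟩, rfl⟩ := e.surjective k
    obtain ⟨i, -, rfl⟩ := Finset.mem_image.1 hx
    exact ⟨i, rfl⟩
  let b : Fin I.card → ℕ := fun k => (Finset.univ.filter fun i => h i = k).card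
  let c : Composition n :=
    { blocks := List.ofFn b
      blocks_pos := by
        intro i hi
        obtain ⟨k, rfl⟩ := (List.mem_ofFn' _ _).1 hi
        obtain ⟨i, hi⟩ := hsurj k
        exact Finset.card_pos.2 ⟨i, by simp [hi]⟩
      blocks_sum := by
        rw [List.sum_ofFn, ← Finset.card_eq_sum_card_fiberwise (fun _ _ => Finset.mem_univ _)]
        simp }
  have hsize : ∀ k, k ≤ I.card →
      c.sizeUpTo k = (Finset.univ.filter fun i => (h i : ℕ) < k).card := by
    intro k
    induction k with
    | zero => simp
    | succ k ih =>
      intro hk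
      have hk' : k < c.length := by simpa [c, Composition.length] using hk
      rw [c.sizeUpTo_succ hk', ih (by omega)]
      have : c.blocks[k] = (Finset.univ.filter fun i => (h i : ℕ) = k).card := by
        simp [c, b, Fin.ext_iff]
      rw [this, ← Finset.card_union_of_disjoint]
      · congr 1
        ext i
        simp
        omega
      · rw [Finset.disjoint_filter]
        intros
        omega
  refine ⟨c, fun i j => ?_⟩
  have hidx : ∀ i, ((c.index i : ℕ)) = h i := by
    intro i
    have h1 : c.sizeUpTo (h i) ≤ i := by
      rw [hsize _ (h i).2.le]
      calc _ ≤ (Finset.Iio i).card := by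
            apply Finset.card_le_card
            intro x hx
            simp only [Finset.mem_filter, Finset.mem_univ, true_and] at hx
            exact Finset.mem_Iio.2 (hmono.reflect_lt hx)
        _ = i := by simp
    have h2 : (i : ℕ) < c.sizeUpTo (h i + 1) := by
      rw [hsize _ (h i).2]
      calc (i : ℕ) < (Finset.Iic i).card := by simp
        _ ≤ _ := by
            apply Finset.card_le_card
            intro x hx
            simp only [Finset.mem_filter, Finset.mem_univ, true_and]
            exact Nat.lt_succ_of_le (hmono (Finset.mem_Iic.1 hx))
    have h3 := c.sizeUpTo_index_le i
    have h4 := c.lt_sizeUpTo_index_succ i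
    rcases lt_trichotomy (c.index i : ℕ) (h i) with hlt | heq | hgt
    · have := c.monotone_sizeUpTo (show (c.index i).succ.val ≤ h i by simpa using hlt)
      omega
    · exact heq
    · have := c.monotone_sizeUpTo (show (h i : ℕ) + 1 ≤ c.index i from hgt)
      omega
  rw [← hinj, Fin.ext_iff, Fin.ext_iff, hidx, hidx]

/-- The composition whose blocks are the level sets of a monotone word. -/
noncomputable def levelComposition {α : Type*} [LinearOrder α] {f : Fin n → α}
    (hf : Monotone f) : Composition n :=
  (exists_composition hf).choose

theorem levelComposition_index {α : Type*} [LinearOrder α] {f : Fin n → α}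
    (hf : Monotone f) (i j : Fin n) :
    (levelComposition hf).index i = (levelComposition hf).index j ↔ f i = f j :=
  (exists_composition hf).choose_spec i j

/-- The words `g` that are rearrangements of `q.index`, weakly increasing on the blocks of `r`.
They index the terms of the product of the basis elements attached to `r` and `q`. -/
abbrev Word (r q : Composition n) : Type :=
  {g : Fin n → Fin q.length //
    (∃ ρ : Perm (Fin n), g = q.index ∘ ρ) ∧ Monotone fun i => toLex (r.index i, g i)}

open Classical in
noncomputable instance (r q : Composition n) : Fintype (Word r q) :=
  inferInstance

/-- The common refinement of `r` by the level sets of `g`. -/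
noncomputable def Word.comp {r q : Composition n} (g : Word r q) : Composition n :=
  levelComposition g.2.2

theorem Word.comp_index {r q : Composition n} (g : Word r q) (i j : Fin n) :
    g.comp.index i = g.comp.index j ↔ r.index i = r.index j ∧ g.1 i = g.1 j := by
  rw [Word.comp, levelComposition_index]
  simp

section Ring

variable (F : Type*) [CommRing F]

/-- `Ξ^q`: the sum of the minimal coset representatives of the Young subgroup of `q`, in the group
algebra of the symmetric group (with the left-to-right product). -/
noncomputable def Xi (q : Composition n) : MonoidAlgebra F (Perm (Fin n))ᵐᵒᵖ :=
  ∑ σ ∈ minCosetReps q, MonoidAlgebra.of F (Perm (Fin n))ᵐᵒᵖ (MulOpposite.op σ)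

theorem monotone_of_mem {r q : Composition n} {σ : Perm (Fin n)} (hσ : σ ∈ minCosetReps r) :
    Monotone fun i => toLex (r.index i, (q.index ∘ σ) i) := by
  intro i j hij
  rcases hij.eq_or_lt with rfl | hij
  · exact le_rfl
  rw [Prod.Lex.toLex_le_toLex]
  rcases (index_mono r hij.le).lt_or_eq with h | h
  · exact Or.inl h
  · exact Or.inr ⟨h, index_mono q (mem_minCosetReps.1 hσ i j hij h).le⟩

theorem sort_eq {q : Composition n} {τ : Perm (Fin n)} (hτ : τ ∈ minCosetReps q) :
    Tuple.sort (q.index ∘ (τ⁻¹ : Perm (Fin n))) = τ := by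
  symm
  rw [Tuple.eq_sort_iff]
  have : (q.index ∘ (τ⁻¹ : Perm (Fin n))) ∘ τ = q.index := by ext; simp
  rw [this]
  refine ⟨index_mono q, fun i j hij h => ?_⟩
  exact mem_minCosetReps.1 hτ i j hij (by simpa using h)

theorem sort_mem {q : Composition n} (ρ : Perm (Fin n)) :
    Tuple.sort (q.index ∘ ρ) ∈ minCosetReps q := by
  rw [mem_minCosetReps]
  intro i j hij h
  refine (Tuple.eq_sort_iff.1 (rfl : Tuple.sort (q.index ∘ ρ) = _)).2 i j hij ?_
  have := sort_comp_eq (index_mono q) ρ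
  have a := congrFun this i
  have b := congrFun this j
  simp only [Function.comp_apply] at a b ⊢
  rw [a, b, h]

/-- Solomon's theorem: products of the `Ξ^q` are sums of such elements. -/
theorem Xi_mul (r q : Composition n) :
    Xi F r * Xi F q = ∑ g : Word r q, Xi F g.comp := by
  classical
  unfold Xi
  rw [Finset.sum_mul_sum, ← Finset.sum_product', Finset.sum_sigma']
  refine Finset.sum_bij'
    (fun x hx => (⟨⟨q.index ∘ x.1, ⟨x.1, rfl⟩,
      monotone_of_mem (Finset.mem_product.1 hx).1⟩, x.2 * x.1⟩ :
        (_ : Word r q) × Perm (Fin n)))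
    (fun y _ => ((Tuple.sort (y.1.1 ∘ (y.2⁻¹ : Perm (Fin n))))⁻¹ * y.2,
      Tuple.sort (y.1.1 ∘ (y.2⁻¹ : Perm (Fin n))))) ?_ ?_ ?_ ?_ ?_
  · rintro ⟨σ, τ⟩ hx
    obtain ⟨hσ, hτ⟩ := Finset.mem_product.1 hx
    refine Finset.mem_sigma.2 ⟨Finset.mem_univ _, ?_⟩
    rw [mem_minCosetReps] at hσ hτ
    refine mem_minCosetReps.2 ?_
    intro i j hij h
    rw [Word.comp_index] at h
    exact hτ _ _ (hσ i j hij h.1) h.2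
  · rintro ⟨⟨g, ⟨ρ, rfl⟩, hm⟩, π⟩ hy
    replace hy := (Finset.mem_sigma.1 hy).2
    simp only
    have e : (q.index ∘ ρ) ∘ (π⁻¹ : Perm (Fin n)) = q.index ∘ (ρ * π⁻¹ : Perm (Fin n)) := rfl
    rw [e]
    set τ := Tuple.sort (q.index ∘ (ρ * π⁻¹ : Perm (Fin n))) with hτd
    have hτ : τ ∈ minCosetReps q := sort_mem _
    have hs : (q.index ∘ (ρ * π⁻¹ : Perm (Fin n))) ∘ τ = q.index :=
      sort_comp_eq (index_mono q) _
    have hs' : ∀ i, q.index ((τ⁻¹ * π) i) = q.index (ρ i) := by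
      intro i
      have := congrFun hs ((τ⁻¹ * π) i)
      simpa using this.symm
    refine Finset.mem_product.2 ⟨?_, hτ⟩
    rw [mem_minCosetReps] at hy hτ ⊢
    intro i j hij h
    simp only
    have h1 := hm hij.le
    simp only [Prod.Lex.toLex_le_toLex, h, lt_irrefl, false_or, true_and,
      Function.comp_apply] at h1
    by_contra! hle
    have hne : (τ⁻¹ * π) j ≠ (τ⁻¹ * π) i := fun h => hij.ne' ((τ⁻¹ * π).injective h)
    have hlt := lt_of_le_of_ne hle hne
    have h2 := index_mono q hle
    rw [hs', hs'] at h2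
    have h3 := le_antisymm h1 h2
    have h4 := hτ _ _ hlt (by rw [hs', hs', h3])
    have h5 := hy i j hij ((Word.comp_index _ i j).2 ⟨h, h3⟩)
    simp at h4
    exact absurd h4 h5.not_gt
  · rintro ⟨σ, τ⟩ hx
    obtain ⟨hσ, hτ⟩ := Finset.mem_product.1 hx
    have e : (q.index ∘ σ) ∘ ((τ * σ)⁻¹ : Perm (Fin n)) = q.index ∘ (τ⁻¹ : Perm (Fin n)) := by
      ext; simp
    simp only [e, sort_eq hτ]
    simp
  · rintro ⟨⟨g, ⟨ρ, rfl⟩, hm⟩, π⟩ hy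
    have e : (q.index ∘ ρ) ∘ (π⁻¹ : Perm (Fin n)) = q.index ∘ (ρ * π⁻¹ : Perm (Fin n)) := rfl
    simp only
    have hs : (q.index ∘ (ρ * π⁻¹ : Perm (Fin n))) ∘
        (Tuple.sort (q.index ∘ (ρ * π⁻¹ : Perm (Fin n)))) = q.index :=
      sort_comp_eq (index_mono q) _
    refine Sigma.ext (Subtype.ext ?_) (heq_of_eq ?_)
    · simp only
      ext i
      have := congrFun hs (((Tuple.sort (q.index ∘ (ρ * π⁻¹ : Perm (Fin n))))⁻¹ * π) i)
      rw [e]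
      simpa using (congrArg Fin.val this).symm
    · simp
  · rintro ⟨σ, τ⟩ hx
    simp [← MulOpposite.op_mul]

theorem exists_Xi_one (n : ℕ) : ∃ c : Composition n,
    (∀ i j, c.index i = c.index j) ∧ Xi F c = 1 := by
  have hm : Monotone (fun _ : Fin n => (0 : ℕ)) := monotone_const
  refine ⟨levelComposition hm, fun i j => (levelComposition_index hm i j).2 rfl, ?_⟩
  have : minCosetReps (levelComposition hm) = {1} := by
    ext σ
    rw [mem_minCosetReps, Finset.mem_singleton]
    constructor
    · intro h
      have hs : StrictMono σ := fun i j hij => h i j hij (by rw [levelComposition_index])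
      have h1 := (Equiv.Perm.monotone_iff σ).1 hs.monotone
      exact h1
    · rintro rfl i j hij -
      exact hij
  rw [Xi, this, Finset.sum_singleton]
  exact map_one _

/-- The descent algebra `D_n(F)`: the linear span of the elements `Ξ^q`, for `q` a composition of
`n`, which is a subalgebra of the group algebra. -/
noncomputable def descentAlgebra (n : ℕ) : Subalgebra F (MonoidAlgebra F (Perm (Fin n))ᵐᵒᵖ) :=
  (Submodule.span F (Set.range (Xi F : Composition n → _))).toSubalgebra
    (by
      obtain ⟨c, -, hc⟩ := exists_Xi_one F n
      exact hc ▸ Submodule.subset_span ⟨c, rfl⟩)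
    (by
      intro a b ha hb
      have h := Submodule.mul_mem_mul ha hb
      rw [Submodule.span_mul_span] at h
      refine Submodule.span_le.2 ?_ h
      rintro _ ⟨_, ⟨r, rfl⟩, _, ⟨q, rfl⟩, rfl⟩
      simp only [Xi_mul]
      exact Submodule.sum_mem _ fun g _ => Submodule.subset_span ⟨_, rfl⟩)


theorem index_surjective (c : Composition n) : Function.Surjective c.index := fun k =>
  ⟨c.embedding k ⟨0, c.one_le_blocksFun k⟩, c.index_embedding _ _⟩

theorem blocksFun_eq_card (c : Composition n) (k : Fin c.length) :
    c.blocksFun k = Nat.card {i // c.index i = k} := by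
  have : {i | c.index i = k} = Set.range (c.embedding k) := by
    ext i
    rw [c.mem_range_embedding_iff']
    exact eq_comm
  change _ = Nat.card ({i | c.index i = k} : Set (Fin n))
  rw [this, Nat.card_range_of_injective (c.embedding k).injective, Nat.card_fin]

theorem composition_ext {c c' : Composition n}
    (h : ∀ i j, c.index i = c.index j ↔ c'.index i = c'.index j) : c = c' := by
  have hle : ∀ i j, c.index i ≤ c.index j ↔ c'.index i ≤ c'.index j := by
    intro i j
    rcases le_total i j with hij | hij
    · simp [index_mono c hij, index_mono c' hij]
    · constructor <;> intro h1
      · exact ((h i j).1 (le_antisymm h1 (index_mono c hij))).le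
      · exact ((h i j).2 (le_antisymm h1 (index_mono c' hij))).le
  choose s hs using index_surjective c
  choose s' hs' using index_surjective c'
  let e : Fin c.length ≃o Fin c'.length :=
    { toFun := fun k => c'.index (s k)
      invFun := fun k => c.index (s' k)
      left_inv := fun k => by
        have : c.index (s' (c'.index (s k))) = c.index (s k) := (h _ _).2 (hs' _)
        exact this.trans (hs k)
      right_inv := fun k => by
        have : c'.index (s (c.index (s' k))) = c'.index (s' k) := (h _ _).1 (hs _)
        exact this.trans (hs' k)
      map_rel_iff' := by
        intro a b
        simp only [Equiv.coe_fn_mk]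
        rw [← hle, hs, hs] }
  have hlen : c.length = c'.length := by simpa using Fintype.card_congr e.toEquiv
  have he : ∀ k, (e k : ℕ) = k := fun k => by simp
  have hb : ∀ k, c.blocksFun k = c'.blocksFun (e k) := by
    intro k
    rw [blocksFun_eq_card, blocksFun_eq_card]
    refine Nat.card_congr (Equiv.subtypeEquivRight fun i => ?_)
    change _ ↔ c'.index i = c'.index (s k)
    rw [← h, hs]
  ext1
  refine List.ext_getElem hlen fun k h1 h2 => ?_
  have := hb ⟨k, h1⟩
  have h3 : e ⟨k, h1⟩ = ⟨k, h2⟩ := Fin.ext (he _)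
  rw [h3] at this
  simpa [Composition.blocksFun] using this

theorem apply_inv (τ : Perm (Fin n)) (i : Fin n) : τ (τ⁻¹ i) = i := by simp

/-- A permutation whose descents are exactly the block boundaries of `r`. -/
theorem exists_descents (r : Composition n) : ∃ w : Perm (Fin n), ∀ i j, i < j →
    (w i < w j ↔ r.index i = r.index j) := by
  set f : Fin n → (Fin r.length)ᵒᵈ := fun i => OrderDual.toDual (r.index i) with hf
  obtain ⟨h1, h2⟩ := Tuple.eq_sort_iff.1 (rfl : Tuple.sort f = _)
  set τ := Tuple.sort f
  refine ⟨τ⁻¹, fun i j hij => ⟨fun h => ?_, fun h => ?_⟩⟩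
  · have := h1 h.le
    simp only [Function.comp_apply, apply_inv] at this
    exact le_antisymm (index_mono r hij.le) this
  · by_contra! hle
    have hlt := lt_of_le_of_ne hle (fun h => hij.ne' ((τ⁻¹).injective h))
    have := h2 _ _ hlt (by simp [hf, h])
    simp only [apply_inv] at this
    exact absurd this hij.not_gt

theorem Xi_apply (q : Composition n) (σ : Perm (Fin n)) [Decidable (σ ∈ minCosetReps q)] :
    (Xi F q).coeff (MulOpposite.op σ) = if σ ∈ minCosetReps q then 1 else 0 := by
  classical
  simp [Xi, Finsupp.single_apply]

theorem linearIndependent_Xi : LinearIndependent F (Xi F : Composition n → _) := by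
  classical
  rw [Fintype.linearIndependent_iff]
  intro a ha
  by_contra! hne
  let K : Composition n → ℕ := fun q =>
    (Finset.univ.filter fun x : Fin n × Fin n => q.index x.1 = q.index x.2).card
  obtain ⟨r, hr, hmin⟩ := Finset.exists_min_image
    (Finset.univ.filter fun q => a q ≠ 0) K (by
      obtain ⟨q, hq⟩ := hne
      exact ⟨q, by simp [hq]⟩)
  obtain ⟨w, hw⟩ := exists_descents r
  have h1 := congrArg (fun x => x.coeff (MulOpposite.op w)) ha
  simp only [MonoidAlgebra.coeff_sum, MonoidAlgebra.coeff_smul, Finsupp.finsetSum_apply,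
    Finsupp.smul_apply, Xi_apply, MonoidAlgebra.coeff_zero, Finsupp.coe_zero, Pi.zero_apply,
    smul_eq_mul, mul_ite, mul_one, mul_zero] at h1
  rw [Finset.sum_eq_single r] at h1
  · rw [if_pos] at h1
    · exact (Finset.mem_filter.1 hr).2 h1
    · exact mem_minCosetReps.2 fun i j hij h => (hw i j hij).2 h
  · intro q _ hqr
    split_ifs with hq
    · by_contra haq
      have hK := hmin q (by simp [haq])
      rw [mem_minCosetReps] at hq
      have hlt : ∀ i j, i < j → q.index i = q.index j → r.index i = r.index j :=
        fun i j hij h => (hw i j hij).1 (hq i j hij h)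
      have himp : ∀ i j, q.index i = q.index j → r.index i = r.index j := by
        intro i j h
        rcases lt_trichotomy i j with h' | rfl | h'
        · exact hlt i j h' h
        · rfl
        · exact (hlt j i h' h.symm).symm
      have hsub : (Finset.univ.filter fun x : Fin n × Fin n => q.index x.1 = q.index x.2) ⊆
          (Finset.univ.filter fun x : Fin n × Fin n => r.index x.1 = r.index x.2) := by
        intro x hx
        simp only [Finset.mem_filter, Finset.mem_univ, true_and] at hx ⊢
        exact himp _ _ hx
      have heq := Finset.eq_of_subset_of_card_le hsub hK
      refine hqr (composition_ext fun i j => ⟨himp i j, fun h => ?_⟩)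
      have : (i, j) ∈ (Finset.univ.filter fun x : Fin n × Fin n =>
          r.index x.1 = r.index x.2) := by simp [h]
      rw [← heq] at this
      simpa using this
    · rfl
  · simp

end Ring

/-- The number of cosets of the Young subgroup of `q` fixed by `π`. -/
noncomputable def fixedCosets (q : Composition n) (π : Perm (Fin n)) : ℕ :=
  Nat.card (MulAction.fixedBy (Perm (Fin n) ⧸ youngSubgroup q) π)

/-- rearrangements of a word fixed by π -/
abbrev FixedWord {α : Type*} (f : Fin n → α) (π : Perm (Fin n)) : Type _ :=
  {w : Fin n → α // (∃ ρ : Perm (Fin n), w = f ∘ ρ) ∧ w ∘ π = w}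

theorem fixedCosets_eq (q : Composition n) (π : Perm (Fin n)) :
    fixedCosets q π = Nat.card (FixedWord q.index π) := by
  have key : ∀ σ τ : Perm (Fin n), ((σ : Perm (Fin n) ⧸ youngSubgroup q) = τ) ↔
      q.index ∘ (σ⁻¹ : Perm (Fin n)) = q.index ∘ (τ⁻¹ : Perm (Fin n)) := by
    intro σ τ
    rw [QuotientGroup.eq]
    constructor
    · intro h
      ext i
      have := h (τ⁻¹ i)
      simp at this
      simp [this]
    · intro h i
      have := congrFun h (τ i)
      simpa using this
  have fix : ∀ σ : Perm (Fin n), (π • (σ : Perm (Fin n) ⧸ youngSubgroup q) = σ) ↔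
      (q.index ∘ (σ⁻¹ : Perm (Fin n))) ∘ π = q.index ∘ (σ⁻¹ : Perm (Fin n)) := by
    intro σ
    rw [eq_comm]
    change ((σ : Perm (Fin n) ⧸ youngSubgroup q) = ((π * σ : Perm (Fin n)) : _ ⧸ _)) ↔ _
    rw [key]
    constructor
    · intro h
      ext i
      have := congrFun h (π i)
      simpa using congrArg Fin.val this
    · intro h
      ext i
      have := congrFun h (π⁻¹ i)
      simpa using congrArg Fin.val this
  unfold fixedCosets
  symm
  refine Nat.card_eq_of_bijective (fun w => (⟨((w.2.1.choose)⁻¹ : Perm (Fin n)), ?_⟩ :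
    MulAction.fixedBy (Perm (Fin n) ⧸ youngSubgroup q) π)) ⟨?_, ?_⟩
  · change π • (((w.2.1.choose)⁻¹ : Perm (Fin n)) : Perm (Fin n) ⧸ youngSubgroup q) = _
    rw [fix]
    simp only [inv_inv]
    rw [← w.2.1.choose_spec, w.2.2]
  · intro w w' h
    have h := congrArg Subtype.val h
    simp only at h
    rw [key] at h
    simp only [inv_inv] at h
    rw [← w.2.1.choose_spec, ← w'.2.1.choose_spec] at h
    exact Subtype.ext h
  · rintro ⟨x, hx⟩
    obtain ⟨σ, rfl⟩ := QuotientGroup.mk_surjective x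
    have hx' := (fix σ).1 hx
    refine ⟨⟨q.index ∘ (σ⁻¹ : Perm (Fin n)), ⟨_, rfl⟩, hx'⟩, Subtype.ext ?_⟩
    simp only
    rw [key]
    generalize_proofs h
    rw [inv_inv, ← h.choose_spec]

theorem card_fixedWord_congr {α β : Type*} {f : Fin n → α} {g : Fin n → β}
    (h : ∀ i j, f i = f j ↔ g i = g j) (π : Perm (Fin n)) :
    Nat.card (FixedWord f π) = Nat.card (FixedWord g π) := by
  refine Nat.card_eq_of_bijective
    (fun w => (⟨g ∘ w.2.1.choose, ⟨_, rfl⟩, ?_⟩ : FixedWord g π)) ⟨?_, ?_⟩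
  · ext i
    have h1 := congrFun w.2.2 i
    have h2 : ∀ i, w.1 i = f (w.2.1.choose i) := congrFun w.2.1.choose_spec
    simp only [Function.comp_apply, h2] at h1 ⊢
    exact (h _ _).1 h1
  · intro w w' hw
    have hw := congrArg Subtype.val hw
    refine Subtype.ext ?_
    rw [w.2.1.choose_spec, w'.2.1.choose_spec]
    ext i
    exact (h _ _).2 (congrFun hw i)
  · rintro ⟨_, ⟨ρ, rfl⟩, hfix⟩
    refine ⟨⟨f ∘ ρ, ⟨ρ, rfl⟩, ?_⟩, Subtype.ext ?_⟩
    · ext i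
      exact (h _ _).2 (congrFun hfix i)
    · simp only
      generalize_proofs h'
      ext i
      exact (h _ _).1 (congrFun h'.choose_spec i).symm

theorem fixedCosets_mul (r q : Composition n) (π : Perm (Fin n)) :
    fixedCosets r π * fixedCosets q π = ∑ g : Word r q, fixedCosets g.comp π := by
  have h1 : ∀ g : Word r q, fixedCosets g.comp π =
      Nat.card (FixedWord (fun i => toLex (r.index i, g.1 i)) π) := by
    intro g
    rw [fixedCosets_eq]
    refine card_fixedWord_congr (fun i j => ?_) π
    rw [Word.comp_index]
    simp
  simp only [h1]
  rw [← Nat.card_sigma, fixedCosets_eq, fixedCosets_eq, ← Nat.card_prod]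
  symm
  refine Nat.card_eq_of_bijective (fun x : (g : Word r q) × FixedWord _ π =>
    ((⟨fun i => (ofLex (x.2.1 i)).1, ?_, ?_⟩, ⟨fun i => (ofLex (x.2.1 i)).2, ?_, ?_⟩) :
      FixedWord r.index π × FixedWord q.index π)) ⟨?_, ?_⟩
  · obtain ⟨g, w, ⟨ρ, rfl⟩, hw⟩ := x
    exact ⟨ρ, rfl⟩
  · obtain ⟨g, w, hρ, hw⟩ := x
    ext i
    simpa using congrArg (fun a => ((ofLex a).1 : ℕ)) (congrFun hw i)
  · obtain ⟨⟨g, ⟨ρ', rfl⟩, hg⟩, w, ⟨ρ, rfl⟩, hw⟩ := x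
    exact ⟨ρ' * ρ, rfl⟩
  · obtain ⟨g, w, hρ, hw⟩ := x
    ext i
    simpa using congrArg (fun a => ((ofLex a).2 : ℕ)) (congrFun hw i)
  · rintro ⟨g, w, hρ, hw⟩ ⟨g', w', hρ', hw'⟩ h
    have e : w = w' := by
      ext i : 1
      have e1 := congrFun (congrArg (fun x => x.1.1) h) i
      have e2 := congrFun (congrArg (fun x => x.2.1) h) i
      exact ofLex.injective (Prod.ext e1 e2)
    subst e
    obtain ⟨ρ, rfl⟩ := hρ
    obtain ⟨ρ', h'⟩ := hρ'
    have a := sort_comp_eq g.2.2 ρ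
    have b := sort_comp_eq g'.2.2 ρ'
    rw [← h'] at b
    have eg : g = g' := by
      refine Subtype.ext ?_
      ext i : 1
      have := congrFun (a.symm.trans b) i
      exact congrArg (fun a => (ofLex a).2) this
    subst eg
    rfl
  · rintro ⟨⟨_, ⟨ρ, rfl⟩, hu⟩, ⟨_, ⟨ρ', rfl⟩, hv⟩⟩
    set w : Fin n → Fin r.length ×ₗ Fin q.length :=
      fun i => toLex (r.index (ρ i), q.index (ρ' i)) with hw
    set s := Tuple.sort w with hs
    have hm : Monotone (w ∘ s) := Tuple.monotone_sort w
    have hr : (r.index ∘ ρ) ∘ s = r.index := by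
      have m1 : Monotone (r.index ∘ (ρ * s : Perm (Fin n))) := by
        intro i j hij
        rcases Prod.Lex.toLex_le_toLex.1 (hm hij) with h | h
        · exact h.le
        · exact h.1.le
      have m2 : Monotone (r.index ∘ (1 : Perm (Fin n))) := by simpa using index_mono r
      have := Tuple.unique_monotone m1 m2
      simpa [Function.comp_assoc] using this
    have hr' : ∀ i, r.index (ρ (s i)) = r.index i := congrFun hr
    refine ⟨⟨⟨q.index ∘ (ρ' * s : Perm (Fin n)), ⟨_, rfl⟩, ?_⟩, ⟨w, ⟨s⁻¹, ?_⟩, ?_⟩⟩, ?_⟩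
    · intro i j hij
      have := hm hij
      simp only [hw, Function.comp_apply, hr'] at this
      exact this
    · ext i : 1
      have := hr' (s⁻¹ i)
      simp only [apply_inv] at this
      simp [hw, this]
    · ext i : 1
      have a := congrFun hu i
      have b := congrFun hv i
      simp only [Function.comp_apply] at a b
      simp [hw, a, b]
    · rfl


theorem exists_perm_parts (μ : n.Partition) :
    ∃ π : Perm (Fin n), π.partition.parts = μ.parts := by
  classical
  have hsplit := Multiset.filter_add_not (fun k => 2 ≤ k) μ.parts
  have hone : μ.parts.filter (fun k => ¬ 2 ≤ k) =
      Multiset.replicate (μ.parts.filter (fun k => ¬ 2 ≤ k)).card 1 := by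
    refine Multiset.eq_replicate_card.2 fun k hk => ?_
    have h1 := μ.parts_pos (Multiset.mem_of_mem_filter hk)
    have h2 := Multiset.of_mem_filter hk
    omega
  have hsum : (μ.parts.filter (fun k => 2 ≤ k)).sum +
      (μ.parts.filter (fun k => ¬ 2 ≤ k)).card = n := by
    have := congrArg Multiset.sum hsplit
    rw [Multiset.sum_add, hone, μ.parts_sum] at this
    simpa using this
  obtain ⟨g, hg⟩ := (Perm.exists_with_cycleType_iff (Fin n)
    (m := μ.parts.filter (fun k => 2 ≤ k))).2
    ⟨by rw [Fintype.card_fin]; omega, fun a ha => Multiset.of_mem_filter ha⟩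
  refine ⟨g, ?_⟩
  rw [Perm.parts_partition, ← Perm.sum_cycleType, hg, Fintype.card_fin]
  conv_rhs => rw [← hsplit, hone]
  congr 2
  omega

/-- A permutation of cycle type `μ` (fixed points counted as parts equal to `1`). -/
noncomputable def permOfPartition (μ : n.Partition) : Perm (Fin n) :=
  (exists_perm_parts μ).choose

/-- The value `φ^q(μ)` of the Young permutation character: the number of cosets of the Young
subgroup of `q` that are fixed by a permutation of cycle type `μ`. -/
noncomputable def youngCharacter (q : Composition n) (μ : n.Partition) : ℕ :=
  Nat.card (MulAction.fixedBy (Perm (Fin n) ⧸ youngSubgroup q) (permOfPartition μ))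

universe u

variable (F : Type u) [Field F]

/-- `Ξ^q` as an element of the descent algebra. -/
noncomputable def xi (q : Composition n) : descentAlgebra F n :=
  ⟨Xi F q, Submodule.subset_span ⟨q, rfl⟩⟩

/-- The elements `Ξ^q` form a basis of the descent algebra. -/
noncomputable def xiBasis (n : ℕ) : Module.Basis (Composition n) F (descentAlgebra F n) :=
  Module.Basis.span (linearIndependent_Xi F)

theorem xiBasis_apply (q : Composition n) : xiBasis F n q = xi F q :=
  Subtype.ext (congrArg Subtype.val (Module.Basis.span_apply (linearIndependent_Xi F) q))

theorem xi_mul (r q : Composition n) : xi F r * xi F q = ∑ g : Word r q, xi F g.comp := by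
  ext1
  simp [xi, Xi_mul]

/-- The algebra homomorphism `D_n(F) → F` with `Ξ^q ↦ φ^q(μ)`. -/
noncomputable def simpleCharacter (μ : n.Partition) : descentAlgebra F n →ₐ[F] F :=
  AlgHom.ofLinearMap ((xiBasis F n).constr F fun q => (youngCharacter q μ : F))
    (by
      obtain ⟨c, hc, h1⟩ := exists_Xi_one F n
      have : (1 : descentAlgebra F n) = xiBasis F n c := by
        rw [xiBasis_apply]; exact Subtype.ext h1.symm
      rw [this, Module.Basis.constr_basis]
      have : youngCharacter c μ = 1 := by
        have h2 : fixedCosets c (permOfPartition μ) = 1 := by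
          rw [fixedCosets_eq, Nat.card_eq_one_iff_unique]
          refine ⟨⟨?_⟩, ⟨⟨c.index, ⟨1, rfl⟩, funext fun i => hc _ _⟩⟩⟩
          rintro ⟨_, ⟨ρ, rfl⟩, -⟩ ⟨_, ⟨ρ', rfl⟩, -⟩
          exact Subtype.ext (funext fun i => hc _ _)
        exact h2
      simp [this])
    (by
      have h : (LinearMap.mul F (descentAlgebra F n)).compr₂
            ((xiBasis F n).constr F fun q => (youngCharacter q μ : F)) =
          (LinearMap.mul F F).compl₁₂
            ((xiBasis F n).constr F fun q => (youngCharacter q μ : F))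
            ((xiBasis F n).constr F fun q => (youngCharacter q μ : F)) := by
        refine (xiBasis F n).ext fun r => (xiBasis F n).ext fun q => ?_
        simp only [LinearMap.compr₂_apply, LinearMap.mul_apply', LinearMap.compl₁₂_apply,
          Module.Basis.constr_basis]
        rw [xiBasis_apply, xiBasis_apply, xi_mul, map_sum]
        simp only [← xiBasis_apply, Module.Basis.constr_basis]
        have := fixedCosets_mul r q (permOfPartition μ)
        simp only [fixedCosets] at this
        simp only [youngCharacter]
        rw [← Nat.cast_mul, ← Nat.cast_sum, this]
      intro x y
      exact LinearMap.congr_fun (LinearMap.congr_fun h x) y)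

theorem simpleCharacter_xi (q : Composition n) (μ : n.Partition) :
    simpleCharacter F μ (xi F q) = youngCharacter q μ := by
  rw [← xiBasis_apply]
  exact (xiBasis F n).constr_basis F (fun q => (youngCharacter q μ : F)) q


/-- The one-dimensional module `M_μ`: the space `F`, on which `Ξ^q` acts as the scalar `φ^q(μ)`. -/
def SimpleModule (_μ : n.Partition) : Type _ := F

noncomputable instance (μ : n.Partition) : AddCommGroup (SimpleModule F μ) :=
  inferInstanceAs (AddCommGroup F)

noncomputable instance (μ : n.Partition) : Module (descentAlgebra F n) (SimpleModule F μ) :=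
  Module.compHom F (simpleCharacter F μ).toRingHom

theorem smul_simpleModule (μ : n.Partition) (a : descentAlgebra F n) (v : SimpleModule F μ) :
    a • v = (HMul.hMul (α := F) (β := F) (simpleCharacter F μ a) v : F) := rfl

/-- `p`-regular partitions: no part occurs `p` or more times (no condition if `p = 0`). -/
def IsRegular (p : ℕ) (μ : n.Partition) : Prop :=
  p ≠ 0 → ∀ i, μ.parts.count i < p

/-- `h` is the `p'`-part of the element `g` of a finite group: `g = u * h` with `u` a commuting
`p`-element and `h` of order prime to `p`.  For `p = 0` this says `h = g`. -/
def IsPrimeToPart (p : ℕ) {G : Type*} [Group G] (g h : G) : Prop :=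
  ∃ u : G, g = u * h ∧ Commute u h ∧ (∃ k : ℕ, orderOf u = p ^ k) ∧ ¬ p ∣ orderOf h

/-- `p`-equivalence of partitions: the `p'`-parts of permutations of cycle types `μ` and `ν` are
conjugate. -/
def PEquivalent (p : ℕ) (μ ν : n.Partition) : Prop :=
  ∀ σ τ : Perm (Fin n), σ.partition.parts = μ.parts → τ.partition.parts = ν.parts →
    ∀ σ' τ' : Perm (Fin n), IsPrimeToPart p σ σ' → IsPrimeToPart p τ τ' → IsConj σ' τ'

/-- The partition `μ # (s)` of `n + s` obtained from `μ` by adding a part `s`. -/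
def addPart (μ : n.Partition) (s : ℕ) : (n + s).Partition :=
  Nat.Partition.ofSums (n + s) (s ::ₘ μ.parts) (by
    rw [Multiset.sum_cons, μ.parts_sum, add_comm])

/-- The number of arrows `lam ⟶ mu`, which is `dim_F Ext¹(M_lam, M_mu)`, the Ext group being taken
in the category of left `D_n(F)`-modules. -/
noncomputable def numArrows (lam mu : n.Partition) : ℕ :=
  Module.finrank F (CategoryTheory.Abelian.Ext
    (ModuleCat.of (descentAlgebra F n) (SimpleModule F lam))
    (ModuleCat.of (descentAlgebra F n) (SimpleModule F mu)) 1)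

/-- The vertices of the Ext quiver of `D_n(F)`, for `F` of characteristic `p`: the `p`-regular
partitions `lam` of `n`, which label the simple modules `M_lam`. -/
def ExtQuiver (_F : Type u) [Field _F] (p n : ℕ) : Type :=
  {lam : n.Partition // IsRegular p lam}

/-- The arrows of the Ext quiver: `dim_F Ext¹(M_lam, M_mu)` of them from `lam` to `mu`. -/
noncomputable instance (p n : ℕ) : Quiver (ExtQuiver F p n) where
  Hom lam mu := Fin (numArrows F lam.1 mu.1)

end Descent

/-!
The descent algebra `D_n(F)` is the algebra of `S_n`-invariants of the algebra of the monoid of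
faces of the braid arrangement (Bidigare), and the scalar by which `x` acts on the simple module
`M_μ` is the sum of its coefficients at the faces fixed by a permutation of cycle type `μ`.
Restricting faces of `m + s` points to the first `m` points, and killing those that separate the
last `s` points, gives an algebra homomorphism `Δ : D_{m+s}(F) → D_m(F)`. A face of `m + s` points
is fixed by `π ⊔ (an s-cycle)` exactly when it does not separate the last `s` points and its
restriction is fixed by `π`; hence the pullback of `M_μ` along `Δ` is the simple module attached to
`μ` with a part `s` added, which is isomorphic to `M_{μ^{#s}}` because fixed points of `p`-power
order elements are counted modulo `p`.

Let `r⁺` be `r` with its first part enlarged by `s`. Then `Δ(Ξ^{r⁺})` is `Ξ^r` plus terms `Ξ^q`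
with a larger first part, so `Δ` is surjective. For one-dimensional modules, `Ext¹` is the space of
twisted derivations modulo the inner ones, and pulling derivations back along a surjection is
injective on this quotient.
-/

namespace Descent

open Equiv

universe u

/-! ### `Ext¹` between one-dimensional modules -/

section TwistedDerivations

open CategoryTheory Abelian

variable {F A : Type u} [Field F] [Ring A] [Algebra F A]

/-- The derivations from `A` to `F`, where `A` acts on the left of `F` through the character `ψ`
and on the right through `χ`. Modulo the inner ones they compute `Ext¹` from `χ` to `ψ`. -/
def twistedDerivations (χ ψ : A →ₐ[F] F) : Submodule F (A →ₗ[F] F) where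
  carrier := {d | ∀ a b, d (a * b) = ψ a * d b + d a * χ b}
  add_mem' hd he a b := by
    simp only [LinearMap.add_apply, hd a b, he a b]
    ring
  zero_mem' := by simp
  smul_mem' c d hd a b := by
    simp only [LinearMap.smul_apply, hd a b, smul_eq_mul]
    ring

theorem twistedDerivations_one {χ ψ : A →ₐ[F] F} (d : twistedDerivations χ ψ) : d.1 1 = 0 := by
  simpa using d.2 1 1

/-- The one-dimensional module on which `A` acts through the character `χ`. -/
def CharModule (_χ : A →ₐ[F] F) : Type u := F

noncomputable instance (χ : A →ₐ[F] F) : AddCommGroup (CharModule χ) :=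
  inferInstanceAs (AddCommGroup F)

noncomputable instance (χ : A →ₐ[F] F) : Module A (CharModule χ) :=
  Module.compHom F χ.toRingHom

/-- The character `χ` as the orbit map `a ↦ a • 1` of `A`-modules. -/
def toCharModule (χ : A →ₐ[F] F) : A →ₗ[A] CharModule χ where
  toFun a := (χ a : F)
  map_add' := map_add χ
  map_smul' := map_mul χ

theorem toCharModule_surjective (χ : A →ₐ[F] F) : Function.Surjective (toCharModule χ) :=
  fun c => ⟨algebraMap F _ c, χ.commutes c⟩

theorem sub_algebraMap_mem_ker (χ : A →ₐ[F] F) (a : A) :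
    a - algebraMap F A (χ a) ∈ LinearMap.ker (toCharModule χ) := by
  change χ (a - algebraMap F _ (χ a)) = 0
  rw [map_sub, AlgHom.commutes]
  exact sub_self _

/-- The restriction of a twisted derivation to the kernel of `χ`, where it is `A`-linear. -/
def restrictKer {χ ψ : A →ₐ[F] F} (d : twistedDerivations χ ψ) :
    LinearMap.ker (toCharModule χ) →ₗ[A] CharModule ψ where
  toFun k := (d.1 k.1 : F)
  map_add' x y := map_add d.1 x.1 y.1
  map_smul' a k := by
    have hk : χ k.1 = 0 := k.2
    have := d.2 a k.1
    rw [hk, mul_zero, add_zero] at this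
    exact this

theorem restrictKer_surjective (χ ψ : A →ₐ[F] F) :
    Function.Surjective (restrictKer (χ := χ) (ψ := ψ)) := by
  intro f
  let g : LinearMap.ker (toCharModule χ) → F := fun k => f k
  have g_add (x y) : g (x + y) = g x + g y := map_add f x y
  have g_smul (a : A) (x) : g (a • x) = ψ a * g x := map_smul f a x
  let proj (a : A) : LinearMap.ker (toCharModule χ) := ⟨_, sub_algebraMap_mem_ker χ a⟩
  have proj_add (a b : A) : proj (a + b) = proj a + proj b := by
    ext1
    simp only [proj, map_add, Submodule.coe_add]
    abel
  have proj_smul (c : F) (a : A) : proj (c • a) = algebraMap F A c • proj a := by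
    ext1
    simp [proj, mul_sub, Algebra.smul_def]
  have proj_mul (a b : A) : proj (a * b) = a • proj b + algebraMap F A (χ b) • proj a := by
    ext1
    simp only [proj, map_mul, Submodule.coe_add, Submodule.coe_smul, smul_eq_mul, mul_sub]
    rw [Algebra.commutes (χ b) a, Algebra.commutes (χ b) (algebraMap F _ (χ a))]
    abel
  let d : A →ₗ[F] F :=
    { toFun := fun a => g (proj a)
      map_add' := fun a b => by rw [proj_add, g_add]
      map_smul' := fun c a => by rw [proj_smul, g_smul, AlgHom.commutes]; rfl }
  refine ⟨⟨d, fun a b => ?_⟩, LinearMap.ext fun k => congrArg f (?_ : proj k = k)⟩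
  · change g (proj (a * b)) = ψ a * g (proj b) + g (proj a) * χ b
    rw [proj_mul, g_add, g_smul, g_smul, AlgHom.commutes, mul_comm (g (proj a))]
    rfl
  · have hk : χ k.1 = 0 := k.2
    ext1
    simp [proj, hk]

theorem exists_extends_restrictKer_iff {χ ψ : A →ₐ[F] F} (d : twistedDerivations χ ψ) :
    (∃ f : A →ₗ[A] CharModule ψ, f ∘ₗ (LinearMap.ker (toCharModule χ)).subtype = restrictKer d) ↔
      d.1 ∈ F ∙ (ψ.toLinearMap - χ.toLinearMap) := by
  rw [Submodule.mem_span_singleton]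
  constructor
  · rintro ⟨f, hf⟩
    let g : A → F := fun a => f a
    have g_eq (a : A) : g a = ψ a * g 1 := by
      have h : g (a • 1) = ψ a * g 1 := map_smul f a 1
      rwa [smul_eq_mul, mul_one] at h
    refine ⟨g 1, LinearMap.ext fun a => ?_⟩
    have h : g (a - algebraMap F A (χ a)) = d.1 (a - algebraMap F A (χ a)) :=
      LinearMap.congr_fun hf ⟨_, sub_algebraMap_mem_ker χ a⟩
    rw [g_eq, map_sub, map_sub, Algebra.algebraMap_eq_smul_one, map_smul, map_smul,
      twistedDerivations_one, map_one] at h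
    simpa [mul_comm] using h
  · rintro ⟨c, hc⟩
    refine ⟨LinearMap.toSpanSingleton A (CharModule ψ) c, LinearMap.ext fun k => ?_⟩
    have hk : χ k.1 = 0 := k.2
    have h := LinearMap.congr_fun hc k.1
    simp only [LinearMap.smul_apply, LinearMap.sub_apply, AlgHom.toLinearMap_apply, hk, sub_zero,
      smul_eq_mul, mul_comm c] at h
    exact h

/-- The class in `Ext¹` of the pushout of `0 → ker χ → A → F → 0` along the restriction of a
twisted derivation to `ker χ`. -/
noncomputable def toExt (χ ψ : A →ₐ[F] F) :
    twistedDerivations χ ψ →ₗ[F]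
      Ext (ModuleCat.of A (CharModule χ)) (ModuleCat.of A (CharModule ψ)) 1 :=
  Ext.precompOfLinear
      (LinearMap.shortExact_shortComplexKer (toCharModule_surjective χ)).extClass F
      (ModuleCat.of A (CharModule ψ)) (add_zero 1) ∘ₗ
    (Ext.linearEquiv₀ (R := F)).symm.toLinearMap ∘ₗ
    { toFun := fun d => ModuleCat.ofHom (restrictKer d)
      map_add' := fun _ _ => rfl
      map_smul' := fun c d => by
        ext x
        change (c * d.1 x.1 : F) = (ψ (algebraMap F _ c) * d.1 x.1 : F)
        rw [AlgHom.commutes]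
        rfl }

theorem toExt_apply {χ ψ : A →ₐ[F] F} (d : twistedDerivations χ ψ) :
    toExt χ ψ d =
      (LinearMap.shortExact_shortComplexKer (toCharModule_surjective χ)).extClass.comp
        (Ext.mk₀ (ModuleCat.ofHom (restrictKer d))) (add_zero 1) := rfl

theorem toExt_surjective (χ ψ : A →ₐ[F] F) : Function.Surjective (toExt χ ψ) := by
  intro x
  have : Projective (ModuleCat.of A A) :=
    ModuleCat.projective_of_free (Module.Basis.singleton Unit A)
  obtain ⟨y, hy⟩ := Ext.contravariant_sequence_exact₃
    (LinearMap.shortExact_shortComplexKer (toCharModule_surjective χ)) _ x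
    (Ext.eq_zero_of_projective (P := ModuleCat.of A A) _) (add_zero 1)
  obtain ⟨f, rfl⟩ := (Ext.mk₀_bijective _ _).2 y
  obtain ⟨d, hd⟩ := restrictKer_surjective χ ψ f.hom
  exact ⟨d, by rw [toExt_apply, hd]; exact hy⟩

theorem toExt_eq_zero_iff {χ ψ : A →ₐ[F] F} (d : twistedDerivations χ ψ) :
    toExt χ ψ d = 0 ↔ d.1 ∈ F ∙ (ψ.toLinearMap - χ.toLinearMap) := by
  rw [← exists_extends_restrictKer_iff, toExt_apply]
  constructor
  · intro h
    obtain ⟨y, hy⟩ := Ext.contravariant_sequence_exact₁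
      (LinearMap.shortExact_shortComplexKer (toCharModule_surjective χ)) _ _ _ h
    obtain ⟨f, rfl⟩ := (Ext.mk₀_bijective _ _).2 y
    rw [Ext.mk₀_comp_mk₀] at hy
    exact ⟨f.hom, congrArg ModuleCat.Hom.hom ((Ext.mk₀_bijective _ _).1 hy)⟩
  · rintro ⟨f, hf⟩
    have : ModuleCat.ofHom (restrictKer d) =
        (toCharModule χ).shortComplexKer.f ≫ ModuleCat.ofHom f := by rw [← hf]; rfl
    rw [this, ← Ext.mk₀_comp_mk₀, ← Ext.comp_assoc_of_second_deg_zero,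
      ShortComplex.ShortExact.extClass_comp, Ext.zero_comp]

variable {B : Type u} [Ring B] [Algebra F B]

/-- The pullback of twisted derivations along an algebra homomorphism. -/
def pullbackDerivation (Δ : A →ₐ[F] B) (χ ψ : B →ₐ[F] F) :
    twistedDerivations χ ψ →ₗ[F] twistedDerivations (χ.comp Δ) (ψ.comp Δ) where
  toFun d := ⟨d.1 ∘ₗ Δ.toLinearMap, fun a b => by simpa using d.2 (Δ a) (Δ b)⟩
  map_add' _ _ := rfl
  map_smul' _ _ := rfl

theorem toExt_pullbackDerivation_eq_zero_iff {Δ : A →ₐ[F] B} (hΔ : Function.Surjective Δ)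
    {χ ψ : B →ₐ[F] F} (d : twistedDerivations χ ψ) :
    toExt _ _ (pullbackDerivation Δ χ ψ d) = 0 ↔ toExt χ ψ d = 0 := by
  simp only [toExt_eq_zero_iff, Submodule.mem_span_singleton]
  refine exists_congr fun c => ⟨fun h => LinearMap.ext (hΔ.forall.2 (LinearMap.congr_fun h)),
    fun h => LinearMap.ext fun a => LinearMap.congr_fun h (Δ a)⟩

theorem finrank_ext_le_of_surjective [FiniteDimensional F A]
    {Δ : A →ₐ[F] B} (hΔ : Function.Surjective Δ) (χ ψ : B →ₐ[F] F) :
    Module.finrank F (Ext (ModuleCat.of B (CharModule χ)) (ModuleCat.of B (CharModule ψ)) 1) ≤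
      Module.finrank F (Ext (ModuleCat.of A (CharModule (χ.comp Δ)))
        (ModuleCat.of A (CharModule (ψ.comp Δ))) 1) := by
  obtain ⟨σ, hσ⟩ := (toExt χ ψ).exists_rightInverse_of_surjective
    (LinearMap.range_eq_top.2 (toExt_surjective χ ψ))
  have : FiniteDimensional F (Ext (ModuleCat.of A (CharModule (χ.comp Δ)))
      (ModuleCat.of A (CharModule (ψ.comp Δ))) 1) :=
    Module.Finite.of_surjective _ (toExt_surjective (χ.comp Δ) (ψ.comp Δ))
  refine LinearMap.finrank_le_finrank_of_injective
    (f := toExt (χ.comp Δ) (ψ.comp Δ) ∘ₗ pullbackDerivation Δ χ ψ ∘ₗ σ) ?_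
  refine (injective_iff_map_eq_zero _).2 fun v hv => ?_
  rw [← LinearMap.id_apply (R := F) v, ← hσ]
  exact (toExt_pullbackDerivation_eq_zero_iff hΔ (σ v)).1 hv

end TwistedDerivations

theorem numArrows_le_of_surjective {F : Type u} [Field F] {n m : ℕ}
    {Δ : descentAlgebra F n →ₐ[F] descentAlgebra F m}
    (hΔ : Function.Surjective Δ) {lam mu : m.Partition} {lam' mu' : n.Partition}
    (hlam : simpleCharacter F lam' = (simpleCharacter F lam).comp Δ)
    (hmu : simpleCharacter F mu' = (simpleCharacter F mu).comp Δ) :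
    numArrows F lam mu ≤ numArrows F lam' mu' := by
  have : FiniteDimensional F (descentAlgebra F n) := Module.Finite.of_basis (xiBasis F n)
  have h := finrank_ext_le_of_surjective hΔ (simpleCharacter F lam) (simpleCharacter F mu)
  rw [← hlam, ← hmu] at h
  exact h

/-! ### The monoid of faces -/

theorem exists_perm_comp_eq_of_map_eq {ι α : Type*} [Fintype ι] {f g : ι → α}
    (h : Finset.univ.val.map f = Finset.univ.val.map g) : ∃ σ : Perm ι, g ∘ σ = f := by
  classical
  have e (c : α) : {i // f i = c} ≃ {i // g i = c} := by
    refine Fintype.equivOfCardEq ?_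
    have hc := congrArg (Multiset.count c) h
    simp only [Multiset.count_map, eq_comm (a := c)] at hc
    rw [Fintype.card_subtype, Fintype.card_subtype]
    exact hc
  exact ⟨Equiv.ofFiberEquiv e, funext (Equiv.ofFiberEquiv_map e)⟩

theorem span_range_eq_top_of_unitriangular {ι R M : Type*} [Finite ι] [DecidableEq ι] [Ring R]
    [AddCommGroup M] [Module R M] (b : Module.Basis ι R M) (v : ι → M) (N : ι → ℕ)
    (h : ∀ i j, N j ≤ N i → b.repr (v i) j = if i = j then 1 else 0) :
    Submodule.span R (Set.range v) = ⊤ := by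
  have := Fintype.ofFinite ι
  obtain ⟨B, hB⟩ := (Set.finite_range N).bddAbove
  have mem (i : ι) : b i ∈ Submodule.span R (Set.range v) := by
    induction hk : B - N i using Nat.strong_induction_on generalizing i with
    | _ k ih =>
      rw [← sub_sub_cancel (v i) (b i)]
      refine Submodule.sub_mem _ (Submodule.subset_span ⟨i, rfl⟩) ?_
      rw [← b.sum_repr (v i - b i)]
      refine Submodule.sum_mem _ fun j _ => ?_
      by_cases hj : N j ≤ N i
      · simp [h i j hj, Finsupp.single_apply]
      · have hBj : N j ≤ B := hB ⟨j, rfl⟩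
        exact Submodule.smul_mem _ _ (ih (B - N j) (by omega) j rfl)
  rw [eq_top_iff, ← b.span_eq, Submodule.span_le]
  rintro _ ⟨i, rfl⟩
  exact mem i

/-- A total preorder on `ι`, that is, a face of the braid arrangement. -/
@[ext]
structure Face (ι : Type*) where
  le : ι → ι → Prop
  total : ∀ i j, le i j ∨ le j i
  trans : ∀ i j k, le i j → le j k → le i k

namespace Face

variable {ι κ α β : Type*}

theorem refl (G : Face ι) (i : ι) : G.le i i := (G.total i i).elim id id

noncomputable instance [Finite ι] : Fintype (Face ι) :=
  @Fintype.ofFinite _ (Finite.of_injective Face.le fun _ _ => Face.ext)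

/-- The Tits product of faces: break the ties of the first preorder by the second. -/
instance : Monoid (Face ι) where
  one := ⟨fun _ _ => True, by simp, by simp⟩
  mul G H :=
    { le := fun i j => G.le i j ∧ (G.le j i → H.le i j)
      total := fun i j => by
        have := G.total i j
        have := H.total i j
        tauto
      trans := fun i j k hij hjk => by
        refine ⟨G.trans i j k hij.1 hjk.1, fun hki => H.trans i j k (hij.2 ?_) (hjk.2 ?_)⟩
        · exact G.trans j k i hjk.1 hki
        · exact G.trans k i j hki hij.1 }
  mul_assoc G H K := by
    ext i j
    change ((_ ∧ (_ → _)) ∧ (_ ∧ (_ → _) → _)) ↔ (_ ∧ (_ → _ ∧ (_ → _)))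
    tauto
  one_mul G := by
    ext i j
    change (True ∧ (True → _)) ↔ _
    simp
  mul_one G := by
    ext i j
    change (_ ∧ (_ → True)) ↔ _
    simp

theorem one_le (i j : ι) : (1 : Face ι).le i j := trivial

theorem mul_le {G H : Face ι} {i j : ι} : (G * H).le i j ↔ G.le i j ∧ (G.le j i → H.le i j) :=
  Iff.rfl

theorem eq_one_iff {G : Face ι} : G = 1 ↔ ∀ i j, G.le i j :=
  ⟨fun h i j => h ▸ one_le i j, fun h => by ext i j; exact iff_of_true (h i j) (one_le i j)⟩

theorem mul_eq_one_iff {G H : Face ι} : G * H = 1 ↔ G = 1 ∧ H = 1 := by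
  simp only [eq_one_iff, mul_le]
  exact ⟨fun h => ⟨fun i j => (h i j).1, fun i j => (h i j).2 (h j i).1⟩,
    fun h i j => ⟨h.1 i j, fun _ => h.2 i j⟩⟩

/-- The pullback of a total preorder along a map. -/
def comap (f : κ → ι) : Face ι →* Face κ where
  toFun G := ⟨fun i j => G.le (f i) (f j), fun _ _ => G.total _ _, fun _ _ _ => G.trans _ _ _⟩
  map_one' := rfl
  map_mul' _ _ := rfl

theorem comap_le (f : κ → ι) (G : Face ι) (i j : κ) : (comap f G).le i j ↔ G.le (f i) (f j) :=
  Iff.rfl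

instance : MulDistribMulAction (Perm ι) (Face ι) where
  smul ρ := comap ⇑ρ⁻¹
  one_smul _ := rfl
  mul_smul _ _ _ := rfl
  smul_one _ := rfl
  smul_mul _ _ _ := rfl

theorem smul_le (ρ : Perm ι) (G : Face ι) (i j : ι) :
    (ρ • G).le i j ↔ G.le (ρ⁻¹ i) (ρ⁻¹ j) := Iff.rfl

section Of

variable [LinearOrder α] [LinearOrder β]

/-- The pullback of a linear order along a map. -/
def of (f : ι → α) : Face ι :=
  ⟨fun i j => f i ≤ f j, fun _ _ => le_total _ _, fun _ _ _ => le_trans⟩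

theorem of_le (f : ι → α) (i j : ι) : (of f).le i j ↔ f i ≤ f j := Iff.rfl

theorem smul_of (ρ : Perm ι) (f : ι → α) : ρ • of f = of (f ∘ ⇑ρ⁻¹) := rfl

theorem of_eq_of_iff {f : ι → α} {g : ι → β} :
    of f = of g ↔ ∀ i j, f i ≤ f j ↔ g i ≤ g j :=
  ⟨fun h i j => by rw [← of_le, h, of_le], fun h => by ext i j; exact h i j⟩

theorem of_mul_of (f : ι → α) (g : ι → β) : of f * of g = of fun i => toLex (f i, g i) := by
  ext i j
  rw [mul_le, of_le, of_le, of_le, of_le, Prod.Lex.toLex_le_toLex]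
  rcases lt_trichotomy (f i) (f j) with h | h | h
  · simp [h, h.le, h.not_ge]
  · simp [h]
  · simp [h.not_ge, h.not_gt, h.ne']

theorem monotone_of_of_eq_of [Preorder ι] {f : ι → α} {g : ι → β} (h : of f = of g)
    (hg : Monotone g) :
    Monotone f := fun i j hij => (of_eq_of_iff.1 h i j).2 (hg hij)

theorem of_eq_of_of_monotone [LinearOrder ι] {f : ι → α} {g : ι → β} (hf : Monotone f)
    (hg : Monotone g) (h : ∀ i j, f i = f j ↔ g i = g j) : of f = of g := by
  refine of_eq_of_iff.2 fun i j => ?_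
  rcases le_total i j with hij | hij
  · exact iff_of_true (hf hij) (hg hij)
  · simpa [le_antisymm_iff, hf hij, hg hij] using h i j

end Of

section Rank

variable [Fintype ι]

open Classical in
/-- The number of elements strictly below `i`. -/
noncomputable def rank (G : Face ι) (i : ι) : ℕ :=
  (Finset.univ.filter fun j => ¬ G.le i j).card

theorem rank_le_rank (G : Face ι) {i j : ι} : G.rank i ≤ G.rank j ↔ G.le i j := by
  classical
  have subset {i j : ι} (h : G.le i j) :
      (Finset.univ.filter fun k => ¬ G.le i k) ⊆ Finset.univ.filter fun k => ¬ G.le j k :=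
    Finset.monotone_filter_right _ fun k _ hik hjk => hik (G.trans _ _ _ h hjk)
  refine ⟨fun h => ?_, fun h => Finset.card_le_card (subset h)⟩
  by_contra hij
  have hji := (G.total i j).resolve_left hij
  refine absurd h (not_le.2 (Finset.card_lt_card ?_))
  exact (Finset.ssubset_iff_of_subset (subset hji)).2
    ⟨j, by simpa using hij, by simpa using G.refl j⟩

theorem of_rank (G : Face ι) : of G.rank = G := by
  ext i j
  exact G.rank_le_rank

theorem rank_smul (ρ : Perm ι) (G : Face ι) : (ρ • G).rank = G.rank ∘ ⇑ρ⁻¹ := by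
  classical
  funext i
  exact Finset.card_equiv ρ⁻¹ fun j => by simp [smul_le]

theorem rank_eq_zero_iff {G : Face ι} {i : ι} : G.rank i = 0 ↔ ∀ j, G.le i j := by
  simp [rank, Finset.filter_eq_empty_iff]

/-- The multiset of ranks, a complete invariant of the orbit of a face. -/
noncomputable def ranks (G : Face ι) : Multiset ℕ := Finset.univ.val.map G.rank

theorem ranks_eq_ranks_iff {G H : Face ι} :
    G.ranks = H.ranks ↔ G ∈ MulAction.orbit (Perm ι) H := by
  constructor
  · intro h
    obtain ⟨σ, hσ⟩ := exists_perm_comp_eq_of_map_eq h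
    refine ⟨σ⁻¹, ?_⟩
    change σ⁻¹ • H = G
    rw [← of_rank H, smul_of, inv_inv, hσ, of_rank]
  · rintro ⟨ρ, rfl⟩
    change (ρ • H).ranks = H.ranks
    rw [ranks, rank_smul, ← Multiset.map_map, Multiset.map_univ_val_equiv]
    rfl

end Rank

end Face

/-! ### Faces and compositions -/

theorem index_comp_eq_of_monotone {n : ℕ} {q : Composition n} {σ : Perm (Fin n)}
    (h : Monotone (q.index ∘ σ)) : q.index ∘ σ = q.index := by
  simpa using Tuple.unique_monotone (τ := 1) h (by simpa using index_mono q)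

namespace Face

variable {n : ℕ}

/-- The face whose classes are the blocks of a composition, in their natural order. -/
def ofComposition (q : Composition n) : Face (Fin n) := of q.index

theorem ofComposition_injective : Function.Injective (ofComposition (n := n)) := by
  intro c c' h
  have hle := of_eq_of_iff.1 h
  exact composition_ext fun i j => by rw [le_antisymm_iff, le_antisymm_iff, hle, hle]

theorem smul_ofComposition (σ : Perm (Fin n)) (q : Composition n) :
    σ • ofComposition q = of (q.index ∘ ⇑σ⁻¹) := rfl

theorem mem_orbit_ofComposition_iff {G : Face (Fin n)} {q : Composition n} :
    G ∈ MulAction.orbit (Perm (Fin n)) (ofComposition q) ↔ ∃ σ : Perm (Fin n),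
      G = of (q.index ∘ σ) :=
  ⟨fun ⟨σ, hσ⟩ => ⟨σ⁻¹, hσ.symm⟩, fun ⟨σ, hσ⟩ => ⟨σ⁻¹, by rw [hσ]; rfl⟩⟩

theorem of_index_comp_injective {q : Composition n} {σ τ : Perm (Fin n)}
    (h : of (q.index ∘ σ) = of (q.index ∘ τ)) : q.index ∘ σ = q.index ∘ τ := by
  have h' : of (q.index ∘ ⇑(σ * τ⁻¹)) = of q.index := by
    have := congrArg (τ • ·) h
    simpa only [smul_of, Function.comp_assoc, ← Perm.coe_mul, mul_inv_cancel, Perm.coe_one,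
      Function.comp_id] using this
  have := index_comp_eq_of_monotone (monotone_of_of_eq_of h' (index_mono q))
  conv_rhs => rw [← this, Function.comp_assoc, ← Perm.coe_mul, inv_mul_cancel_right]

theorem eq_of_mem_orbit_ofComposition {q q' : Composition n}
    (h : ofComposition q' ∈ MulAction.orbit (Perm (Fin n)) (ofComposition q)) : q' = q := by
  obtain ⟨σ, hσ⟩ := mem_orbit_ofComposition_iff.1 h
  have := index_comp_eq_of_monotone (monotone_of_of_eq_of hσ.symm (index_mono q'))
  rw [this] at hσ
  exact ofComposition_injective hσ

theorem exists_mem_orbit_ofComposition (G : Face (Fin n)) :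
    ∃ q : Composition n, G ∈ MulAction.orbit (Perm (Fin n)) (ofComposition q) := by
  have hm : Monotone (G.rank ∘ Tuple.sort G.rank) := Tuple.monotone_sort _
  refine ⟨levelComposition hm, Tuple.sort G.rank, ?_⟩
  change Tuple.sort G.rank • of (levelComposition hm).index = G
  rw [of_eq_of_of_monotone (index_mono _) hm (levelComposition_index hm), smul_of,
    Function.comp_assoc, ← Perm.coe_mul, mul_inv_cancel, Perm.coe_one, Function.comp_id, of_rank]

/-- The composition whose parts are the sizes of the classes, in order, of a face. -/
noncomputable def type (G : Face (Fin n)) : Composition n := G.exists_mem_orbit_ofComposition.choose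

theorem type_eq_iff {G : Face (Fin n)} {q : Composition n} :
    G.type = q ↔ G ∈ MulAction.orbit (Perm (Fin n)) (ofComposition q) := by
  have hG : G ∈ MulAction.orbit (Perm (Fin n)) (ofComposition G.type) :=
    G.exists_mem_orbit_ofComposition.choose_spec
  refine ⟨fun h => h ▸ hG, fun h => eq_of_mem_orbit_ofComposition ?_⟩
  rw [← MulAction.orbit_eq_iff] at h hG ⊢
  rw [← h, ← hG]

theorem type_ofComposition (q : Composition n) : (ofComposition q).type = q :=
  type_eq_iff.2 (MulAction.mem_orbit_self _)

theorem type_eq_type_iff {G H : Face (Fin n)} :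
    G.type = H.type ↔ G ∈ MulAction.orbit (Perm (Fin n)) H := by
  rw [type_eq_iff, ← MulAction.orbit_eq_iff, ← MulAction.orbit_eq_iff,
    MulAction.orbit_eq_iff.2 (type_eq_iff.1 (rfl : H.type = H.type))]

theorem type_smul (ρ : Perm (Fin n)) (G : Face (Fin n)) : (ρ • G).type = G.type :=
  type_eq_type_iff.2 (MulAction.mem_orbit G ρ)

theorem stabilizer_ofComposition (q : Composition n) :
    MulAction.stabilizer (Perm (Fin n)) (ofComposition q) = youngSubgroup q := by
  ext σ
  rw [MulAction.mem_stabilizer_iff, ← (youngSubgroup q).inv_mem_iff, smul_ofComposition]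
  exact ⟨fun h => congrFun (of_index_comp_injective (τ := 1) h), fun h => congrArg of (funext h)⟩

theorem ofComposition_mul_of {r q : Composition n} (g : Word r q) :
    ofComposition r * of g.1 = ofComposition g.comp := by
  rw [ofComposition, of_mul_of]
  exact of_eq_of_of_monotone g.2.2 (index_mono _) fun i j => by simp [g.comp_index]

theorem type_of_word {r q : Composition n} (g : Word r q) : (of g.1).type = q :=
  type_eq_iff.2 (mem_orbit_ofComposition_iff.2 (g.2.1.imp fun _ h => by rw [h]))

theorem of_word_injective {r q : Composition n} :
    Function.Injective fun g : Word r q => of g.1 := by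
  intro g g' h
  obtain ⟨σ, hσ⟩ := g.2.1
  obtain ⟨σ', hσ'⟩ := g'.2.1
  simp only [hσ, hσ'] at h
  exact Subtype.ext (by rw [hσ, hσ', of_index_comp_injective h])

theorem exists_word_of_mul_eq_ofComposition {r q c : Composition n} {G H : Face (Fin n)}
    (hG : G.type = r) (hH : H.type = q) (hGH : G * H = ofComposition c) :
    ∃ g : Word r q, g.comp = c ∧ ofComposition r = G ∧ of g.1 = H := by
  obtain ⟨σ, rfl⟩ := mem_orbit_ofComposition_iff.1 (type_eq_iff.1 hG)
  obtain ⟨τ, rfl⟩ := mem_orbit_ofComposition_iff.1 (type_eq_iff.1 hH)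
  have hm : Monotone fun i => toLex ((r.index ∘ σ) i, (q.index ∘ τ) i) :=
    monotone_of_of_eq_of (by rw [← of_mul_of, hGH]; rfl) (index_mono c)
  have hr : r.index ∘ σ = r.index :=
    index_comp_eq_of_monotone (Prod.Lex.monotone_fst_ofLex.comp hm)
  rw [hr] at hm hGH ⊢
  refine ⟨⟨q.index ∘ τ, ⟨τ, rfl⟩, hm⟩, ofComposition_injective ?_, rfl, rfl⟩
  rw [← hGH, ← ofComposition_mul_of]
  rfl

open Classical in
theorem card_factorizations_ofComposition (r q c : Composition n) :
    (Finset.univ.filter fun x : Face (Fin n) × Face (Fin n) =>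
      x.1.type = r ∧ x.2.type = q ∧ x.1 * x.2 = ofComposition c).card =
    (Finset.univ.filter fun g : Word r q => g.comp = c).card := by
  symm
  refine Finset.card_bij (fun g _ => (ofComposition r, of g.1)) ?_ ?_ ?_
  · simp only [Finset.mem_filter_univ]
    rintro g rfl
    exact ⟨type_ofComposition r, type_of_word g, ofComposition_mul_of g⟩
  · exact fun g _ g' _ h => of_word_injective (congrArg Prod.snd h)
  · simp only [Finset.mem_filter_univ]
    rintro ⟨G, H⟩ ⟨hG, hH, hGH⟩
    obtain ⟨g, hg, rfl, rfl⟩ := exists_word_of_mul_eq_ofComposition hG hH hGH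
    exact ⟨g, hg, rfl⟩

open Classical in
/-- By `xi_mul`, the right-hand side is the coefficient of `Ξ^{K.type}` in `Ξ^r Ξ^q`. -/
theorem card_factorizations (r q : Composition n) (K : Face (Fin n)) :
    (Finset.univ.filter fun x : Face (Fin n) × Face (Fin n) =>
      x.1.type = r ∧ x.2.type = q ∧ x.1 * x.2 = K).card =
    (Finset.univ.filter fun g : Word r q => g.comp = K.type).card := by
  obtain ⟨ρ, hρ⟩ := type_eq_iff.1 (rfl : K.type = _)
  have hK : ρ⁻¹ • K = ofComposition K.type := inv_smul_eq_iff.2 hρ.symm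
  rw [← card_factorizations_ofComposition]
  refine (Finset.card_equiv (MulAction.toPerm ρ) fun x => ?_).symm
  simp only [Finset.mem_filter_univ, MulAction.toPerm_apply, Prod.smul_fst, Prod.smul_snd,
    type_smul, ← smul_mul', smul_eq_iff_eq_inv_smul, hK]

end Face

/-! ### The descent algebra as an algebra of faces -/

section FaceAlgebra

variable (F : Type u) [Field F] {n : ℕ}

/-- The linear map sending `Ξ^q` to the sum of the faces of type `q`. -/
noncomputable def toFacesLinear : descentAlgebra F n →ₗ[F] MonoidAlgebra F (Face (Fin n)) where
  toFun x := .ofCoeff (Finsupp.equivFunOnFinite.symm fun G => (xiBasis F n).repr x G.type)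
  map_add' x y := by ext G; simp
  map_smul' c x := by ext G; simp

theorem toFacesLinear_coeff (x : descentAlgebra F n) (G : Face (Fin n)) :
    (toFacesLinear F x).coeff G = (xiBasis F n).repr x G.type := rfl

theorem toFacesLinear_one : toFacesLinear F (1 : descentAlgebra F n) = 1 := by
  classical
  obtain ⟨c, hc, hc1⟩ := exists_Xi_one F n
  have one_eq : (1 : descentAlgebra F n) = xiBasis F n c := by
    rw [xiBasis_apply]
    exact Subtype.ext hc1.symm
  have type_eq (G : Face (Fin n)) : G.type = c ↔ G = 1 := by
    have : Face.ofComposition c = 1 := Face.eq_one_iff.2 fun i j => (hc i j).le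
    rw [Face.type_eq_iff, this]
    simp [MulAction.mem_orbit_iff, eq_comm]
  ext G
  rw [one_eq, MonoidAlgebra.one_def]
  simp only [toFacesLinear_coeff, Module.Basis.repr_self, MonoidAlgebra.coeff_single,
    Finsupp.single_apply, eq_comm (a := c), eq_comm (a := (1 : Face (Fin n))), type_eq]

theorem toFacesLinear_mul_xi (r q : Composition n) :
    toFacesLinear F (xi F r * xi F q) = toFacesLinear F (xi F r) * toFacesLinear F (xi F q) := by
  classical
  ext K
  rw [toFacesLinear_coeff, xi_mul, map_sum, MonoidAlgebra.coeff_mul_antidiag _ _ _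
    (Finset.univ.filter fun x => x.1 * x.2 = K) (by simp)]
  simp only [toFacesLinear_coeff, ← xiBasis_apply, Module.Basis.repr_self, Finsupp.single_apply,
    Finsupp.finsetSum_apply, mul_boole, ← ite_and]
  rw [Finset.sum_boole, Finset.sum_boole, ← Face.card_factorizations, Finset.filter_filter]
  congr 2
  ext x
  simp only [Finset.mem_filter_univ]
  tauto

/-- The embedding of the descent algebra into the algebra of the face monoid: `Ξ^q` goes to the
sum of the faces of type `q`. -/
noncomputable def toFaces : descentAlgebra F n →ₐ[F] MonoidAlgebra F (Face (Fin n)) :=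
  AlgHom.ofLinearMap (toFacesLinear F) (toFacesLinear_one F) <| by
    have h : (LinearMap.mul F (descentAlgebra F n)).compr₂ (toFacesLinear F) =
        (LinearMap.mul F (MonoidAlgebra F (Face (Fin n)))).compl₁₂
          (toFacesLinear F) (toFacesLinear F) := by
      refine (xiBasis F n).ext fun r => (xiBasis F n).ext fun q => ?_
      simp only [LinearMap.compr₂_apply, LinearMap.mul_apply', LinearMap.compl₁₂_apply,
        xiBasis_apply]
      exact toFacesLinear_mul_xi F r q
    exact fun x y => LinearMap.congr_fun (LinearMap.congr_fun h x) y

theorem toFaces_coeff (x : descentAlgebra F n) (G : Face (Fin n)) :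
    (toFaces F x).coeff G = (xiBasis F n).repr x G.type := rfl

open Classical in
theorem toFaces_xi_coeff (q : Composition n) (G : Face (Fin n)) :
    (toFaces F (xi F q)).coeff G = if G.type = q then 1 else 0 := by
  rw [toFaces_coeff, ← xiBasis_apply, Module.Basis.repr_self, Finsupp.single_apply]
  simp only [eq_comm]

theorem toFaces_injective : Function.Injective (toFaces F (n := n)) := by
  intro x y h
  refine (xiBasis F n).repr.injective (Finsupp.ext fun q => ?_)
  rw [← Face.type_ofComposition q, ← toFaces_coeff, ← toFaces_coeff, h]

theorem mem_range_toFaces_iff {a : MonoidAlgebra F (Face (Fin n))} :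
    a ∈ (toFaces F (n := n)).range ↔ ∀ (ρ : Perm (Fin n)) G, a.coeff (ρ • G) = a.coeff G := by
  constructor
  · rintro ⟨x, rfl⟩ ρ G
    change (toFaces F x).coeff _ = (toFaces F x).coeff _
    rw [toFaces_coeff, toFaces_coeff, Face.type_smul]
  · intro h
    refine ⟨(xiBasis F n).repr.symm
      (Finsupp.equivFunOnFinite.symm fun q => a.coeff (Face.ofComposition q)), ?_⟩
    ext G
    obtain ⟨ρ, hρ⟩ := Face.type_eq_iff.1 (rfl : G.type = _)
    change ρ • _ = G at hρ
    change (toFaces F _).coeff G = a.coeff G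
    rw [toFaces_coeff, LinearEquiv.apply_symm_apply]
    conv_rhs => rw [← hρ, h]
    rfl

end FaceAlgebra

section FaceMaps

variable (k : Type*) [CommSemiring k] {ι κ σ : Type*}

open Classical in
/-- The algebra homomorphism that kills the faces whose pullback along `g` has more than one
class, and pulls back the others along `f`. -/
noncomputable def restrictFaces (f : κ → ι) (g : σ → ι) :
    MonoidAlgebra k (Face ι) →ₐ[k] MonoidAlgebra k (Face κ) :=
  MonoidAlgebra.lift k _ _
    { toFun := fun G => if Face.comap g G = 1 then .single (Face.comap f G) 1 else 0
      map_one' := by rw [map_one, map_one, if_pos rfl]; rfl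
      map_mul' := fun G H => by
        by_cases hG : Face.comap g G = 1 <;> by_cases hH : Face.comap g H = 1 <;>
          simp [-map_mul, map_mul (Face.comap g), map_mul (Face.comap f), Face.mul_eq_one_iff,
            hG, hH] }

open Classical in
theorem restrictFaces_single (f : κ → ι) (g : σ → ι) (G : Face ι) :
    restrictFaces k f g (.single G 1) =
      if Face.comap g G = 1 then .single (Face.comap f G) 1 else 0 := by
  simp [restrictFaces]

open Classical in
theorem restrictFaces_coeff [Finite ι] (f : κ → ι) (g : σ → ι) (a : MonoidAlgebra k (Face ι))
    (H : Face κ) : (restrictFaces k f g a).coeff H =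
      ∑ G with Face.comap g G = 1 ∧ Face.comap f G = H, a.coeff G := by
  rw [restrictFaces, MonoidAlgebra.lift_apply, Finsupp.sum_fintype _ _ (by simp),
    MonoidAlgebra.coeff_sum, Finsupp.finsetSum_apply, Finset.sum_filter]
  refine Finset.sum_congr rfl fun G _ => ?_
  by_cases hG : Face.comap g G = 1 <;> simp [hG, Finsupp.single_apply]

open Classical in
/-- The sum of the coefficients of the faces fixed by a permutation. -/
noncomputable def faceTrace [Finite ι] (π : Perm ι) : MonoidAlgebra k (Face ι) →ₗ[k] k where
  toFun a := ∑ G with π • G = G, a.coeff G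
  map_add' a b := by simp [Finset.sum_add_distrib]
  map_smul' c a := by simp [Finset.mul_sum]

open Classical in
theorem faceTrace_apply [Finite ι] (π : Perm ι) (a : MonoidAlgebra k (Face ι)) :
    faceTrace k π a = ∑ G with π • G = G, a.coeff G := rfl

open Classical in
theorem faceTrace_single [Finite ι] (π : Perm ι) (G : Face ι) :
    faceTrace k π (.single G 1) = if π • G = G then 1 else 0 := by
  simp [faceTrace_apply, Finsupp.single_apply, Finset.sum_ite_eq]

theorem faceTrace_restrictFaces [Finite ι] [Finite κ] {f : κ → ι} {g : σ → ι} {π : Perm κ}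
    {π' : Perm ι} (h : ∀ G : Face ι, π' • G = G ↔
      Face.comap g G = 1 ∧ π • Face.comap f G = Face.comap f G) (a : MonoidAlgebra k (Face ι)) :
    faceTrace k π (restrictFaces k f g a) = faceTrace k π' a := by
  classical
  suffices faceTrace k π ∘ₗ (restrictFaces k f g).toLinearMap = faceTrace k π' from
    LinearMap.congr_fun this a
  ext G
  simp only [LinearMap.comp_apply, MonoidAlgebra.lsingle_apply, AlgHom.toLinearMap_apply,
    restrictFaces_single, faceTrace_single, h]
  by_cases hG : Face.comap g G = 1 <;> simp [hG, faceTrace_single]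

end FaceMaps

theorem card_fixedBy_quotient {G X : Type*} [Group G] [MulAction G X] {H : Subgroup G} {b : X}
    (hH : MulAction.stabilizer G b = H) (g : G) :
    Nat.card (MulAction.fixedBy (G ⧸ H) g) =
      Nat.card {x : X // x ∈ MulAction.orbit G b ∧ g • x = x} := by
  subst hH
  let e := MulAction.orbitEquivQuotientStabilizer G b
  have he (g : G) (x) : e.symm (g • x) = g • e.symm x :=
    Subtype.ext (MulAction.ofQuotientStabilizer_smul G b g x)
  refine Nat.card_congr ((e.symm.subtypeEquiv fun x => ?_).trans
    (Equiv.subtypeSubtypeEquivSubtypeInter _ fun x => g • x = x))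
  rw [MulAction.mem_fixedBy, ← e.symm.apply_eq_iff_eq, he, Subtype.ext_iff,
    MulAction.orbit.coe_smul]

theorem fixedCosets_eq_card_faces {n : ℕ} (q : Composition n) (π : Perm (Fin n)) :
    fixedCosets q π = Nat.card {G : Face (Fin n) // G.type = q ∧ π • G = G} := by
  simp only [Face.type_eq_iff]
  exact card_fixedBy_quotient (Face.stabilizer_ofComposition q) π

theorem faceTrace_toFaces_xi (F : Type u) [Field F] {n : ℕ} (π : Perm (Fin n))
    (q : Composition n) : faceTrace F π (toFaces F (xi F q)) = fixedCosets q π := by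
  classical
  simp only [faceTrace_apply, toFaces_xi_coeff]
  rw [Finset.sum_boole, Finset.filter_filter, fixedCosets_eq_card_faces, Nat.card_eq_fintype_card,
    Fintype.card_subtype]
  simp only [and_comm]

/-! ### Restriction of faces -/

section FinAdd

variable {m s : ℕ}

/-- The permutation of `Fin (m + s)` that acts on the first `m` points by `ρ` and on the last `s`
points by `τ`. -/
def sumPerm (ρ : Perm (Fin m)) (τ : Perm (Fin s)) : Perm (Fin (m + s)) :=
  finSumFinEquiv.permCongr (Equiv.sumCongr ρ τ)

@[simp]
theorem sumPerm_castAdd (ρ : Perm (Fin m)) (τ : Perm (Fin s)) (i : Fin m) :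
    sumPerm ρ τ (Fin.castAdd s i) = Fin.castAdd s (ρ i) := by
  simp [sumPerm, Equiv.permCongr_apply]

@[simp]
theorem sumPerm_natAdd (ρ : Perm (Fin m)) (τ : Perm (Fin s)) (a : Fin s) :
    sumPerm ρ τ (Fin.natAdd m a) = Fin.natAdd m (τ a) := by
  simp [sumPerm, Equiv.permCongr_apply]

theorem map_univ_fin_add {α : Type*} (f : Fin (m + s) → α) :
    Finset.univ.val.map f =
      Finset.univ.val.map (f ∘ Fin.castAdd s) + Finset.univ.val.map (f ∘ Fin.natAdd m) := by
  have (n : ℕ) (g : Fin n → α) : Finset.univ.val.map g = ∑ i, {g i} := by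
    rw [← Multiset.sum_map_singleton (Finset.univ.val.map g), Multiset.map_map]
    rfl
  rw [this, this, this, Fin.sum_univ_add]
  rfl

theorem card_filter_fin_add (P : Fin (m + s) → Prop) [DecidablePred P] :
    (Finset.univ.filter P).card =
      (Finset.univ.filter fun i => P (Fin.castAdd s i)).card +
        (Finset.univ.filter fun a => P (Fin.natAdd m a)).card := by
  simp only [Finset.card_filter, Fin.sum_univ_add]

theorem eq_of_comp_finRotate {α : Type*} {f : Fin s → α}
    (h : ∀ a, f (finRotate s a) = f a) (a b : Fin s) : f a = f b := by
  cases s with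
  | zero => exact a.elim0
  | succ s =>
    have eq_zero (a : Fin (s + 1)) : f a = f 0 := by
      induction a using Fin.induction with
      | zero => rfl
      | succ i ih => rw [← ih, ← h i.castSucc, finRotate_apply, Fin.coeSucc_eq_succ]
    rw [eq_zero a, eq_zero b]

end FinAdd

namespace Face

theorem comap_smul {ι κ : Type*} {f : κ → ι} {ρ : Perm κ} {ρ' : Perm ι}
    (h : ∀ i, ρ' (f i) = f (ρ i)) (G : Face ι) : comap f (ρ' • G) = ρ • comap f G := by
  have h' (i : κ) : ρ'⁻¹ (f i) = f (ρ⁻¹ i) := by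
    rw [Perm.inv_eq_iff_eq, h, ← Perm.mul_apply, mul_inv_cancel, Perm.one_apply]
  ext i j
  simp only [comap_le, smul_le, h']

theorem rank_eq_rank_iff {ι : Type*} [Fintype ι] {G : Face ι} {i j : ι} :
    G.rank i = G.rank j ↔ G.le i j ∧ G.le j i := by
  rw [le_antisymm_iff, rank_le_rank, rank_le_rank]

theorem smul_eq_self_iff {ι : Type*} [Fintype ι] {π : Perm ι} {G : Face ι} :
    π • G = G ↔ ∀ i, G.rank (π i) = G.rank i := by
  have : π • G = G ↔ G.rank ∘ ⇑π⁻¹ = G.rank := by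
    rw [← rank_smul]
    exact ⟨congrArg rank, fun h => by rw [← of_rank (π • G), h, of_rank]⟩
  rw [this, funext_iff, ← π.forall_congr_right]
  simp [eq_comm]

variable {m s : ℕ}

theorem finRotate_smul_eq_self_iff {G : Face (Fin s)} : finRotate s • G = G ↔ G = 1 := by
  refine ⟨fun h => eq_one_iff.2 fun a b => ?_, fun h => h ▸ smul_one _⟩
  exact G.rank_le_rank.1 (eq_of_comp_finRotate (smul_eq_self_iff.1 h) a b).le

theorem sumPerm_smul_eq_self_iff {π : Perm (Fin m)} {τ : Perm (Fin s)} {G : Face (Fin (m + s))} :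
    sumPerm π τ • G = G ↔ τ • comap (Fin.natAdd m) G = comap (Fin.natAdd m) G ∧
      π • comap (Fin.castAdd s) G = comap (Fin.castAdd s) G := by
  simp only [smul_eq_self_iff, rank_eq_rank_iff, Fin.forall_fin_add, sumPerm_castAdd,
    sumPerm_natAdd, comap_le]
  exact and_comm

end Face

section Restriction

variable (F : Type u) [Field F] {m s : ℕ}

theorem restrictFaces_toFaces_mem (x : descentAlgebra F (m + s)) :
    restrictFaces F (Fin.castAdd s) (Fin.natAdd m) (toFaces F x) ∈
      (toFaces F (n := m)).range := by
  classical
  refine (mem_range_toFaces_iff F).2 fun ρ H => ?_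
  rw [restrictFaces_coeff, restrictFaces_coeff]
  symm
  refine Finset.sum_equiv (MulAction.toPerm (sumPerm ρ (1 : Perm (Fin s))))
    (fun G => ?_) fun G _ => ?_
  · simp only [Finset.mem_filter_univ, MulAction.toPerm_apply,
      Face.comap_smul (sumPerm_castAdd ρ 1), Face.comap_smul (sumPerm_natAdd ρ 1), one_smul,
      smul_left_cancel_iff]
  · rw [MulAction.toPerm_apply, toFaces_coeff, toFaces_coeff, Face.type_smul]

/-- The homomorphism `D_{m+s}(F) → D_m(F)` that, for `s ≥ 1`, sends `Ξ^q` to the sum of the `Ξ^r`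
over all ways to diminish one part of `q` by `s`; a part that becomes `0` is dropped from `r`. -/
noncomputable def descentRestrict : descentAlgebra F (m + s) →ₐ[F] descentAlgebra F m :=
  (AlgEquiv.ofInjective (toFaces F (n := m)) (toFaces_injective F)).symm.toAlgHom.comp
    (((restrictFaces F (Fin.castAdd s) (Fin.natAdd m)).comp (toFaces F)).codRestrict _
      (restrictFaces_toFaces_mem F))

theorem toFaces_descentRestrict (x : descentAlgebra F (m + s)) :
    toFaces F (descentRestrict F x) =
      restrictFaces F (Fin.castAdd s) (Fin.natAdd m) (toFaces F x) :=
  congrArg Subtype.val ((AlgEquiv.ofInjective _ (toFaces_injective F)).apply_symm_apply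
    ⟨_, restrictFaces_toFaces_mem F x⟩)

theorem faceTrace_descentRestrict (π : Perm (Fin m)) (x : descentAlgebra F (m + s)) :
    faceTrace F π (toFaces F (descentRestrict F x)) =
      faceTrace F (sumPerm π (finRotate s)) (toFaces F x) := by
  rw [toFaces_descentRestrict]
  refine faceTrace_restrictFaces F (fun G => ?_) _
  rw [Face.sumPerm_smul_eq_self_iff, Face.finRotate_smul_eq_self_iff]

end Restriction

namespace Face

section MinCount

variable {ι : Type*} [Fintype ι]

/-- The size of the lowest class. -/
noncomputable def minCount (G : Face ι) : ℕ := (Finset.univ.filter fun i => G.rank i = 0).card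

theorem minCount_eq_count_ranks (G : Face ι) : G.minCount = G.ranks.count 0 := by
  rw [ranks, Multiset.count_map]
  simp only [eq_comm (a := 0)]
  rfl

end MinCount

variable {m s : ℕ}

/-- The total preorder on `m + s` points obtained by adding `s` points to the lowest class. -/
noncomputable def extend (s : ℕ) (G : Face (Fin m)) : Face (Fin (m + s)) :=
  of (Fin.addCases G.rank fun _ => 0)

section Extend

variable (G : Face (Fin m)) (i j : Fin m) (a : Fin s)

@[simp]
theorem extend_castAdd_castAdd :
    (extend s G).le (Fin.castAdd s i) (Fin.castAdd s j) ↔ G.le i j := by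
  simp [extend, of_le, rank_le_rank]

@[simp]
theorem extend_castAdd_natAdd :
    (extend s G).le (Fin.castAdd s i) (Fin.natAdd m a) ↔ ∀ j, G.le i j := by
  simp [extend, of_le, rank_eq_zero_iff]

@[simp]
theorem extend_natAdd (k : Fin (m + s)) : (extend s G).le (Fin.natAdd m a) k := by
  simp [extend, of_le]

theorem comap_natAdd_extend : comap (Fin.natAdd m) (extend s G) = 1 :=
  eq_one_iff.2 fun _ _ => extend_natAdd ..

theorem comap_castAdd_extend : comap (Fin.castAdd s) (extend s G) = G := by
  ext i j
  simp [comap_le]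

theorem rank_extend_natAdd : (extend s G).rank (Fin.natAdd m a) = 0 := by
  simp [rank_eq_zero_iff]

theorem rank_extend_castAdd :
    (extend s G).rank (Fin.castAdd s i) = if G.rank i = 0 then 0 else G.rank i + s := by
  classical
  rw [rank, card_filter_fin_add]
  simp only [extend_castAdd_castAdd, extend_castAdd_natAdd, ← rank_eq_zero_iff]
  split_ifs with h
  · simp [rank_eq_zero_iff.1 h, h]
  · rw [Finset.filter_true_of_mem fun _ _ => h, Finset.card_univ, Fintype.card_fin]
    rfl

theorem ranks_extend : (extend s G).ranks =
    G.ranks.map (fun r => if r = 0 then 0 else r + s) + Multiset.replicate s 0 := by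
  rw [ranks, map_univ_fin_add, ranks, Multiset.map_map]
  simp [rank_extend_natAdd, rank_extend_castAdd]

theorem injective_ite_add (s : ℕ) : Function.Injective fun r => if r = 0 then 0 else r + s := by
  intro a b h
  dsimp only at h
  split_ifs at h <;> omega

theorem minCount_extend : (extend s G).minCount = G.minCount + s := by
  have := Multiset.count_map_eq_count' _ G.ranks (injective_ite_add s) 0
  rw [minCount_eq_count_ranks, minCount_eq_count_ranks, ranks_extend, Multiset.count_add,
    Multiset.count_replicate_self, ← this]
  rfl

end Extend

theorem type_eq_type_iff_ranks {G H : Face (Fin m)} : G.type = H.type ↔ G.ranks = H.ranks := by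
  rw [type_eq_type_iff, ranks_eq_ranks_iff]

theorem type_extend_eq_iff {G H : Face (Fin m)} :
    (extend s G).type = (extend s H).type ↔ G.type = H.type := by
  rw [type_eq_type_iff_ranks, ranks_extend, ranks_extend, add_left_inj,
    (Multiset.map_injective (injective_ite_add s)).eq_iff, type_eq_type_iff_ranks]

theorem eq_extend_of_minCount_le {K : Face (Fin (m + s))}
    (h : (comap (Fin.castAdd s) K).minCount + s ≤ K.minCount) :
    K = extend s (comap (Fin.castAdd s) K) := by
  rw [minCount, minCount, card_filter_fin_add] at h
  have subset : (Finset.univ.filter fun i => K.rank (Fin.castAdd s i) = 0) ⊆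
      Finset.univ.filter fun i => (comap (Fin.castAdd s) K).rank i = 0 :=
    Finset.monotone_filter_right _ fun i _ hi =>
      rank_eq_zero_iff.2 fun j => rank_eq_zero_iff.1 hi (Fin.castAdd s j)
  have card_le := Finset.card_le_univ (Finset.univ.filter fun a => K.rank (Fin.natAdd m a) = 0)
  have card_le' := Finset.card_le_card subset
  rw [Fintype.card_fin] at card_le
  have castAdd_le (i : Fin m) (hi : (comap (Fin.castAdd s) K).rank i = 0) (j) :
      K.le (Fin.castAdd s i) j := by
    have := (Finset.ext_iff.1 (Finset.eq_of_subset_of_card_le subset (by omega)) i).2 (by simpa)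
    exact rank_eq_zero_iff.1 (Finset.mem_filter_univ i |>.1 this) j
  have natAdd_le (a : Fin s) (j) : K.le (Fin.natAdd m a) j := by
    have := Finset.eq_univ_of_card (Finset.univ.filter fun a => K.rank (Fin.natAdd m a) = 0)
      (by rw [Fintype.card_fin]; omega)
    exact rank_eq_zero_iff.1 (Finset.filter_eq_self.1 this a (Finset.mem_univ a)) j
  ext i j
  induction i using Fin.addCases with
  | right a => exact iff_of_true (natAdd_le a j) (extend_natAdd ..)
  | left i =>
    induction j using Fin.addCases with
    | left j => rw [extend_castAdd_castAdd, comap_le]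
    | right b =>
      rw [extend_castAdd_natAdd]
      exact ⟨fun h j => K.trans _ _ _ h (natAdd_le b _),
        fun h => castAdd_le i (rank_eq_zero_iff.2 h) _⟩

theorem minCount_eq_of_type_eq {G H : Face (Fin m)} (h : G.type = H.type) :
    G.minCount = H.minCount := by
  rw [minCount_eq_count_ranks, minCount_eq_count_ranks, type_eq_type_iff_ranks.1 h]

theorem comap_eq_and_type_eq_extend_iff {G H : Face (Fin m)} (h : H.minCount ≤ G.minCount)
    {K : Face (Fin (m + s))} :
    comap (Fin.castAdd s) K = H ∧ K.type = (extend s G).type ↔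
      K = extend s H ∧ G.type = H.type := by
  constructor
  · rintro ⟨rfl, hK⟩
    have e := eq_extend_of_minCount_le (K := K) <| by
      rw [minCount_eq_of_type_eq hK, minCount_extend]
      omega
    refine ⟨e, ?_⟩
    rw [e, type_extend_eq_iff] at hK
    exact hK.symm
  · rintro ⟨rfl, hGH⟩
    exact ⟨comap_castAdd_extend H, type_extend_eq_iff.2 hGH.symm⟩

end Face

section Surjectivity

variable (F : Type u) [Field F] {m s : ℕ}

open Classical in
theorem repr_descentRestrict_extend {r q : Composition m}
    (h : (Face.ofComposition q).minCount ≤ (Face.ofComposition r).minCount) :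
    (xiBasis F m).repr
      (descentRestrict F (xi F (Face.extend s (Face.ofComposition r)).type)) q =
      if r = q then 1 else 0 := by
  rw [← Face.type_ofComposition q, ← toFaces_coeff, toFaces_descentRestrict,
    restrictFaces_coeff, Face.type_ofComposition]
  simp only [toFaces_xi_coeff]
  have filter_eq : (Finset.univ.filter fun G : Face (Fin (m + s)) =>
      (Face.comap (Fin.natAdd m) G = 1 ∧ Face.comap (Fin.castAdd s) G = Face.ofComposition q) ∧
        G.type = (Face.extend s (Face.ofComposition r)).type) =
      if r = q then {Face.extend s (Face.ofComposition q)} else ∅ := by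
    ext G
    rw [Finset.mem_filter_univ, and_assoc, Face.comap_eq_and_type_eq_extend_iff h,
      Face.type_ofComposition, Face.type_ofComposition]
    split_ifs with hrq
    · simp only [hrq, and_true, Finset.mem_singleton, and_iff_right_iff_imp]
      rintro rfl
      exact Face.comap_natAdd_extend _
    · simp [hrq]
  rw [Finset.sum_boole, Finset.filter_filter, filter_eq]
  split_ifs <;> simp

theorem descentRestrict_surjective :
    Function.Surjective (descentRestrict F (m := m) (s := s)) := by
  classical
  have span_eq := span_range_eq_top_of_unitriangular (xiBasis F m)
    (fun r => descentRestrict F (xi F (Face.extend s (Face.ofComposition r)).type))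
    (fun r => (Face.ofComposition r).minCount) fun _ _ => repr_descentRestrict_extend F
  rw [← AlgHom.coe_toLinearMap, ← LinearMap.range_eq_top, eq_top_iff, ← span_eq,
    Submodule.span_le]
  rintro _ ⟨r, rfl⟩
  exact ⟨_, rfl⟩

end Surjectivity

open MulAction

/-! ### Characters of `p`-equivalent partitions -/

section PrimeToPart

variable {G X : Type*} [Group G] [MulAction G X] {p : ℕ} {g h u : G}

theorem exists_mul_eq_of_coprime {a b : ℕ} (hab : a.Coprime b) (hg : g ^ (a * b) = 1) :
    ∃ u h, g = u * h ∧ Commute u h ∧ u ^ a = 1 ∧ h ^ b = 1 := by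
  have hg' : g ^ (a * b : ℤ) = 1 := by exact_mod_cast hg
  refine ⟨g ^ (b * a.gcdB b), g ^ (a * a.gcdA b), ?_, Commute.zpow_zpow_self g _ _, ?_, ?_⟩
  · rw [← zpow_add, add_comm, ← Nat.gcd_eq_gcd_ab, hab.gcd_eq_one, Nat.cast_one, zpow_one]
  · rw [← zpow_natCast, ← zpow_mul, mul_right_comm, mul_comm (b : ℤ), zpow_mul, hg', one_zpow]
  · rw [← zpow_natCast, ← zpow_mul, mul_right_comm, zpow_mul, hg', one_zpow]

theorem isPrimeToPart_zero_iff [Finite G] : IsPrimeToPart 0 g h ↔ h = g := by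
  constructor
  · rintro ⟨u, rfl, -, ⟨k, hk⟩, -⟩
    have hk0 : k = 0 := by
      by_contra hk0
      exact (orderOf_pos u).ne' (by rw [hk, zero_pow hk0])
    rw [hk0, pow_zero, orderOf_eq_one_iff] at hk
    rw [hk, one_mul]
  · rintro rfl
    exact ⟨1, (one_mul h).symm, Commute.one_left h, ⟨0, by simp⟩, by simp [(orderOf_pos h).ne']⟩

theorem exists_isPrimeToPart [Finite G] (hp : p.Prime ∨ p = 0) (g : G) :
    ∃ h, IsPrimeToPart p g h := by
  rcases hp with hp | rfl
  · have hcop := Nat.coprime_ordCompl hp (orderOf_pos g).ne'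
    obtain ⟨u, h, hg, hc, hu, hh⟩ := exists_mul_eq_of_coprime (hcop.pow_left _)
      (by rw [Nat.ordProj_mul_ordCompl_eq_self, pow_orderOf_eq_one])
    obtain ⟨k, -, hk⟩ := (Nat.dvd_prime_pow hp).1 (orderOf_dvd_of_pow_eq_one hu)
    exact ⟨h, u, hg, hc, ⟨k, hk⟩, fun hdvd => Nat.not_dvd_ordCompl hp (orderOf_pos g).ne'
      (hdvd.trans (orderOf_dvd_of_pow_eq_one hh))⟩
  · exact ⟨g, isPrimeToPart_zero_iff.2 rfl⟩

theorem period_mul_of_coprime (hc : Commute u h) (hco : (orderOf u).Coprime (orderOf h)) (x : X) :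
    period (u * h) x = period u x * period h x := by
  have hcomm : Function.Commute (fun y : X => u • y) (fun y => h • y) := fun y => by
    simp only [← mul_smul, hc.eq]
  simp only [period_eq_minimalPeriod, mul_smul]
  exact hcomm.minimalPeriod_of_comp_eq_mul_of_coprime
    (hco.of_dvd (period_dvd_orderOf u x) (period_dvd_orderOf h x))

theorem mul_smul_eq_self_iff_of_coprime (hc : Commute u h)
    (hco : (orderOf u).Coprime (orderOf h)) {x : X} :
    (u * h) • x = x ↔ u • x = x ∧ h • x = x := by
  simp only [← period_eq_one_iff, period_mul_of_coprime hc hco, mul_eq_one]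

theorem natCard_fixedBy_mul_modEq [Fact p.Prime] [Finite X] (hc : Commute u h) {k : ℕ}
    (hu : orderOf u = p ^ k) (hco : (orderOf u).Coprime (orderOf h)) :
    Nat.card (fixedBy X (u * h)) ≡ Nat.card (fixedBy X h) [MOD p] := by
  classical
  have := Fintype.ofFinite X
  let f : Perm (fixedBy X h) := (toPerm u).subtypePerm
    ((set_mem_fixedBy_iff _ _).1 (fixedBy_mem_fixedBy_of_commute hc.symm))
  have hf : f ^ p ^ k = 1 := by
    ext x
    simp [f, Perm.subtypePerm_pow, ← hu, ← toPermHom_apply, ← map_pow, pow_orderOf_eq_one]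
  have hfix := Perm.card_fixedPoints_modEq (f := toEndHom (α := fixedBy X h) f)
    (by rw [← map_pow, hf, map_one] : toEndHom f ^ p ^ k = 1)
  have e : fixedBy X (u * h) ≃ Function.fixedPoints (toEndHom (α := fixedBy X h) f) :=
    { toFun := fun x => ⟨⟨x, ((mul_smul_eq_self_iff_of_coprime hc hco).1 x.2).2⟩,
        Subtype.ext ((mul_smul_eq_self_iff_of_coprime hc hco).1 x.2).1⟩
      invFun := fun x => ⟨x.1.1, (mul_smul_eq_self_iff_of_coprime hc hco).2
        ⟨congrArg Subtype.val x.2, x.1.2⟩⟩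
      left_inv := fun _ => rfl
      right_inv := fun _ => rfl }
  rw [Fintype.card_eq_nat_card, Fintype.card_eq_nat_card, ← Nat.card_congr e] at hfix
  exact hfix.symm

theorem IsPrimeToPart.natCard_fixedBy_modEq [Finite G] [Finite X] (hp : p.Prime ∨ p = 0)
    (hgh : IsPrimeToPart p g h) :
    Nat.card (fixedBy X g) ≡ Nat.card (fixedBy X h) [MOD p] := by
  rcases hp with hp | rfl
  · obtain ⟨u, rfl, hc, ⟨k, hk⟩, hh⟩ := hgh
    have := Fact.mk hp
    exact natCard_fixedBy_mul_modEq hc hk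
      (hk ▸ ((Nat.Prime.coprime_iff_not_dvd hp).2 hh).pow_left k)
  · rw [isPrimeToPart_zero_iff.1 hgh]

theorem natCard_fixedBy_eq_of_isConj (hgh : IsConj g h) :
    Nat.card (fixedBy X g) = Nat.card (fixedBy X h) := by
  obtain ⟨c, rfl⟩ := isConj_iff.1 hgh
  rw [← smul_fixedBy, Set.natCard_smul_set]

end PrimeToPart

section Character

variable {n : ℕ} {μ ν : n.Partition}

theorem isConj_iff_parts_eq {σ τ : Perm (Fin n)} :
    IsConj σ τ ↔ σ.partition.parts = τ.partition.parts := by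
  rw [Perm.partition_eq_of_isConj, Nat.Partition.ext_iff]

theorem youngCharacter_eq_fixedCosets (q : Composition n) {σ : Perm (Fin n)}
    (hσ : σ.partition.parts = μ.parts) : youngCharacter q μ = fixedCosets q σ :=
  natCard_fixedBy_eq_of_isConj
    (isConj_iff_parts_eq.2 ((exists_perm_parts μ).choose_spec.trans hσ.symm))

variable (F : Type u) [Field F]

theorem simpleCharacter_eq_faceTrace {σ : Perm (Fin n)} (hσ : σ.partition.parts = μ.parts)
    (x : descentAlgebra F n) : simpleCharacter F μ x = faceTrace F σ (toFaces F x) := by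
  have heq : (simpleCharacter F μ).toLinearMap = faceTrace F σ ∘ₗ (toFaces F).toLinearMap := by
    refine (xiBasis F n).ext fun q => ?_
    simp only [xiBasis_apply, AlgHom.toLinearMap_apply, LinearMap.comp_apply,
      simpleCharacter_xi, faceTrace_toFaces_xi, youngCharacter_eq_fixedCosets q hσ]
  exact LinearMap.congr_fun heq x

theorem simpleCharacter_eq_of_pEquivalent {p : ℕ} [CharP F p] (h : PEquivalent p μ ν) :
    simpleCharacter F μ = simpleCharacter F ν := by
  have hp : p.Prime ∨ p = 0 := CharP.char_is_prime_or_zero F p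
  obtain ⟨σ, hσ⟩ := exists_perm_parts μ
  obtain ⟨τ, hτ⟩ := exists_perm_parts ν
  obtain ⟨σ', hσ'⟩ := exists_isPrimeToPart hp σ
  obtain ⟨τ', hτ'⟩ := exists_isPrimeToPart hp τ
  have hmod (q : Composition n) : youngCharacter q μ ≡ youngCharacter q ν [MOD p] := by
    rw [youngCharacter_eq_fixedCosets q hσ, youngCharacter_eq_fixedCosets q hτ]
    calc fixedCosets q σ
      _ ≡ fixedCosets q σ' [MOD p] := hσ'.natCard_fixedBy_modEq hp
      _ = fixedCosets q τ' := natCard_fixedBy_eq_of_isConj (h σ τ hσ hτ σ' τ' hσ' hτ')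
      _ ≡ fixedCosets q τ [MOD p] := (hτ'.natCard_fixedBy_modEq hp).symm
  refine AlgHom.toLinearMap_injective ((xiBasis F n).ext fun q => ?_)
  simpa only [xiBasis_apply, AlgHom.toLinearMap_apply, simpleCharacter_xi] using
    (CharP.natCast_eq_natCast F p).2 (hmod q)

end Character

/-! ### Cycle types -/

section Period

variable {α : Type*} [Fintype α] [DecidableEq α] {σ : Perm α}

theorem period_eq_of_semiconj {G H X Y : Type*} [Group G] [MulAction G X] [Group H]
    [MulAction H Y] {g : G} {h : H} {f : X → Y} (hf : Function.Injective f)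
    (hfg : ∀ x, h • f x = f (g • x)) (x : X) : period h (f x) = period g x := by
  simp only [period_eq_minimalPeriod, Function.minimalPeriod_eq_minimalPeriod_iff]
  have hfg' : Function.Semiconj f (fun x => g • x) fun y => h • y := fun x => (hfg x).symm
  intro k
  rw [Function.IsPeriodicPt, Function.IsFixedPt, ← (hfg'.iterate_right k).eq, hf.eq_iff]
  rfl

theorem period_eq_card_support_cycleOf {x : α} (hx : x ∈ σ.support) :
    period σ x = (σ.cycleOf x).support.card := by
  have hcycle := σ.isCycle_cycleOf (Perm.mem_support.1 hx)
  have hx' : (σ.cycleOf x) x ≠ x := by simpa using Perm.mem_support.1 hx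
  refine Nat.dvd_right_iff_eq.1 fun k => ?_
  rw [← pow_smul_eq_iff_period_dvd, Perm.smul_def, ← hcycle.orderOf, orderOf_dvd_iff_pow_eq_one,
    hcycle.pow_eq_one_iff' hx', Perm.cycleOf_pow_apply_self]

theorem val_support_eq_bind (σ : Perm α) :
    σ.support.val = σ.cycleFactorsFinset.val.bind fun c => c.support.val := by
  have hdisj : (σ.cycleFactorsFinset : Set (Perm α)).PairwiseDisjoint Perm.support :=
    fun c hc d hd hcd => (σ.cycleFactorsFinset_pairwise_disjoint hc hd hcd).disjoint_support
  rw [← Finset.disjiUnion_val _ _ hdisj, Finset.val_inj]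
  ext x
  simp only [Finset.mem_disjiUnion]
  exact Perm.mem_support_iff_mem_support_of_mem_cycleFactorsFinset

/-- The multiset in which each `k ∈ M` is repeated `k` times. If `M` is the cycle type of a
permutation, this lists for every point the length of the cycle through it. -/
def pointLengths (M : Multiset ℕ) : Multiset ℕ :=
  M.bind fun k => Multiset.replicate k k

theorem pointLengths_add (M N : Multiset ℕ) :
    pointLengths (M + N) = pointLengths M + pointLengths N :=
  Multiset.add_bind M N _

theorem pointLengths_replicate (m k : ℕ) :
    pointLengths (Multiset.replicate m k) = Multiset.replicate (m * k) k := by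
  refine Multiset.eq_replicate.2 ⟨by simp [pointLengths], fun j hj => ?_⟩
  obtain ⟨i, hi, hj⟩ := Multiset.mem_bind.1 hj
  rw [Multiset.eq_of_mem_replicate hj, Multiset.eq_of_mem_replicate hi]

theorem count_pointLengths (M : Multiset ℕ) (d : ℕ) :
    (pointLengths M).count d = M.count d * d := by
  induction M using Multiset.induction_on with
  | empty => simp [pointLengths]
  | cons k M ih =>
    rw [pointLengths, Multiset.cons_bind, Multiset.count_add, ← pointLengths, ih,
      Multiset.count_replicate, Multiset.count_cons]
    split_ifs <;> grind

theorem eq_of_pointLengths_eq {M N : Multiset ℕ} (hM : 0 ∉ M) (hN : 0 ∉ N)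
    (h : pointLengths M = pointLengths N) : M = N := by
  ext d
  rcases Nat.eq_zero_or_pos d with rfl | hd
  · rw [Multiset.count_eq_zero.2 hM, Multiset.count_eq_zero.2 hN]
  · refine Nat.eq_of_mul_eq_mul_right hd ?_
    rw [← count_pointLengths, h, count_pointLengths]

theorem map_period_univ (σ : Perm α) :
    Finset.univ.val.map (fun x : α => period σ x) = pointLengths σ.partition.parts := by
  have hsupp : σ.support.val.map (fun x : α => period σ x) =
      pointLengths σ.cycleType := by
    rw [val_support_eq_bind, pointLengths, Multiset.map_bind, Perm.cycleType_def, Multiset.bind_map]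
    refine Multiset.bind_congr fun c hc => Multiset.eq_replicate.2 ⟨by simp, ?_⟩
    simp only [Multiset.mem_map]
    rintro _ ⟨x, hx, rfl⟩
    rw [period_eq_card_support_cycleOf (Perm.mem_cycleFactorsFinset_support_le hc hx),
      ← Perm.cycle_is_cycleOf hx hc]
    rfl
  have hfix : σ.supportᶜ.val.map (fun x : α => period σ x) =
      Multiset.replicate (Fintype.card α - σ.support.card) 1 := by
    refine Multiset.eq_replicate.2 ⟨by simp [Finset.card_compl], ?_⟩
    simp only [Multiset.mem_map]
    rintro _ ⟨x, hx, rfl⟩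
    simpa [period_eq_one_iff] using hx
  rw [Perm.parts_partition, pointLengths_add, pointLengths_replicate, mul_one, ← hsupp,
    ← hfix, ← Multiset.map_add, ← Finset.disjUnion_val _ _ disjoint_compl_right,
    Finset.disjUnion_eq_union, Finset.union_compl]

end Period

section Parts

variable {n m s : ℕ}

theorem zero_notMem_parts (μ : n.Partition) : 0 ∉ μ.parts :=
  fun h => (μ.parts_pos h).ne rfl

theorem isConj_iff_map_period_eq {σ τ : Perm (Fin n)} :
    IsConj σ τ ↔ Finset.univ.val.map (fun i : Fin n => period σ i) =
      Finset.univ.val.map (fun i : Fin n => period τ i) := by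
  rw [isConj_iff_parts_eq, map_period_univ, map_period_univ]
  exact ⟨fun h => by rw [h],
    eq_of_pointLengths_eq (zero_notMem_parts _) (zero_notMem_parts _)⟩

theorem parts_addPart (μ : n.Partition) (hs : 1 ≤ s) : (addPart μ s).parts = s ::ₘ μ.parts := by
  refine Multiset.filter_eq_self.2 fun k hk => ?_
  rcases Multiset.mem_cons.1 hk with rfl | hk
  · exact Nat.one_le_iff_ne_zero.1 hs
  · exact (μ.parts_pos hk).ne'

theorem parts_partition_finRotate (hs : 1 ≤ s) : (finRotate s).partition.parts = {s} := by
  obtain ⟨k, rfl⟩ := Nat.exists_eq_add_of_le' hs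
  rcases k with - | k
  · rw [zero_add, finRotate_one, ← Perm.one_def, Perm.parts_partition]
    simp
  · rw [Perm.parts_partition, cycleType_finRotate, support_finRotate]
    simp

theorem parts_partition_sumPerm (π : Perm (Fin m)) (τ : Perm (Fin s)) :
    (sumPerm π τ).partition.parts = π.partition.parts + τ.partition.parts := by
  refine eq_of_pointLengths_eq (zero_notMem_parts _) ?_ ?_
  · rw [Multiset.mem_add, not_or]
    exact ⟨zero_notMem_parts _, zero_notMem_parts _⟩
  · rw [pointLengths_add, ← map_period_univ, ← map_period_univ, ← map_period_univ,
      map_univ_fin_add]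
    congr 2
    · exact funext (period_eq_of_semiconj (Fin.castAdd_injective m s) (sumPerm_castAdd π τ))
    · exact funext (period_eq_of_semiconj (Fin.natAdd_injective s m) (sumPerm_natAdd π τ))

theorem simpleCharacter_addPart {F : Type u} [Field F] (hs : 1 ≤ s) (μ : m.Partition) :
    simpleCharacter F (addPart μ s) = (simpleCharacter F μ).comp (descentRestrict F) := by
  obtain ⟨π, hπ⟩ := exists_perm_parts μ
  have hπs : (sumPerm π (finRotate s)).partition.parts = (addPart μ s).parts := by
    rw [parts_partition_sumPerm, hπ, parts_partition_finRotate hs, parts_addPart μ hs, add_comm,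
      Multiset.singleton_add]
  ext x
  rw [AlgHom.comp_apply, simpleCharacter_eq_faceTrace F hπs, simpleCharacter_eq_faceTrace F hπ,
    faceTrace_descentRestrict]

end Parts

/-! ### `p`-equivalence and `p`-regular partitions -/

section PEquivalence

variable {n m s p : ℕ} {μ ν : n.Partition}

/-- The `p'`-parts of the entries of `pointLengths M`: if `M` is the cycle type of a permutation
`σ`, this lists for every point the length of the cycle of the `p'`-part of `σ` through it. -/
def primeToLengths (p : ℕ) (M : Multiset ℕ) : Multiset ℕ :=
  (pointLengths M).map fun k => ordCompl[p] k

theorem primeToLengths_add (M N : Multiset ℕ) :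
    primeToLengths p (M + N) = primeToLengths p M + primeToLengths p N := by
  rw [primeToLengths, pointLengths_add, Multiset.map_add, primeToLengths, primeToLengths]

theorem primeToLengths_replicate (j k : ℕ) :
    primeToLengths p (Multiset.replicate j k) = Multiset.replicate (j * k) (ordCompl[p] k) := by
  rw [primeToLengths, pointLengths_replicate, Multiset.map_replicate]

theorem primeToLengths_zero (M : Multiset ℕ) : primeToLengths 0 M = pointLengths M := by
  simp [primeToLengths]

theorem count_primeToLengths {M : Multiset ℕ} {S : Finset ℕ} (hS : M.toFinset ⊆ S) (d : ℕ) :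
    (primeToLengths p M).count d = ∑ k ∈ S with ordCompl[p] k = d, M.count k * k := by
  have hmem (k : ℕ) (hk : k ∈ pointLengths M) : k ∈ M := by
    obtain ⟨i, hi, hk⟩ := Multiset.mem_bind.1 hk
    rwa [Multiset.eq_of_mem_replicate hk]
  have hcount (k : ℕ) :
      ((pointLengths M).filter fun i => d = ordCompl[p] i).count k =
        if ordCompl[p] k = d then M.count k * k else 0 := by
    rw [Multiset.count_filter, count_pointLengths]
    simp only [eq_comm]
  rw [primeToLengths, Multiset.count_map, ← Multiset.sum_count_eq_card (s := S) fun k hk =>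
    hS (Multiset.mem_toFinset.2 (hmem k (Multiset.mem_of_mem_filter hk))), Finset.sum_filter]
  exact Finset.sum_congr rfl fun k _ => hcount k

theorem IsPrimeToPart.period_eq {G X : Type*} [Group G] [Finite G] [MulAction G X] {g h : G}
    (hp : p.Prime ∨ p = 0) (hgh : IsPrimeToPart p g h) (x : X) :
    period h x = ordCompl[p] (period g x) := by
  rcases hp with hp | rfl
  · obtain ⟨u, rfl, hc, ⟨k, hk⟩, hh⟩ := hgh
    obtain ⟨j, -, hj⟩ := (Nat.dvd_prime_pow hp).1 (hk ▸ period_dvd_orderOf u x)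
    rw [period_mul_of_coprime hc (hk ▸ ((Nat.Prime.coprime_iff_not_dvd hp).2 hh).pow_left k), hj,
      Nat.ordCompl_pow_mul_of_not_dvd _ hp fun hdvd =>
        hh (hdvd.trans (period_dvd_orderOf h x))]
  · rw [isPrimeToPart_zero_iff.1 hgh, Nat.factorization_eq_zero_of_not_prime _ Nat.not_prime_zero,
      pow_zero, Nat.div_one]

theorem isConj_iff_primeToLengths_eq (hp : p.Prime ∨ p = 0) {σ τ σ' τ' : Perm (Fin n)}
    (hσ : IsPrimeToPart p σ σ') (hτ : IsPrimeToPart p τ τ') :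
    IsConj σ' τ' ↔
      primeToLengths p σ.partition.parts = primeToLengths p τ.partition.parts := by
  simp only [isConj_iff_map_period_eq, primeToLengths, ← map_period_univ, Multiset.map_map,
    Function.comp_def, hσ.period_eq hp, hτ.period_eq hp]

theorem pEquivalent_iff (hp : p.Prime ∨ p = 0) :
    PEquivalent p μ ν ↔ primeToLengths p μ.parts = primeToLengths p ν.parts := by
  constructor
  · intro h
    obtain ⟨σ, hσ⟩ := exists_perm_parts μ
    obtain ⟨τ, hτ⟩ := exists_perm_parts ν
    obtain ⟨σ', hσ'⟩ := exists_isPrimeToPart hp σ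
    obtain ⟨τ', hτ'⟩ := exists_isPrimeToPart hp τ
    rw [← hσ, ← hτ, ← isConj_iff_primeToLengths_eq hp hσ' hτ']
    exact h σ τ hσ hτ σ' τ' hσ' hτ'
  · intro h σ τ hσ hτ σ' τ' hσ' hτ'
    rwa [isConj_iff_primeToLengths_eq hp hσ' hτ', hσ, hτ]

theorem primeToLengths_parts_addPart (hs : 1 ≤ s) (μ : n.Partition) :
    primeToLengths p (addPart μ s).parts =
      Multiset.replicate s (ordCompl[p] s) + primeToLengths p μ.parts := by
  rw [parts_addPart μ hs, ← Multiset.singleton_add, primeToLengths_add,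
    ← Multiset.replicate_one, primeToLengths_replicate, one_mul]

theorem exists_card_parts_lt_of_not_isRegular (hp : p.Prime) (hμ : ¬ IsRegular p μ) :
    ∃ ν : n.Partition, ν.parts.card < μ.parts.card ∧
      primeToLengths p ν.parts = primeToLengths p μ.parts := by
  obtain ⟨k, hk⟩ : ∃ k, p ≤ μ.parts.count k := by
    by_contra! h
    exact hμ fun _ => h
  obtain ⟨t, ht⟩ := Multiset.le_iff_exists_add.1 (Multiset.le_count_iff_replicate_le.1 hk)
  have hpos (i : ℕ) (hi : i ∈ {p * k} + t) : 0 < i := by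
    rcases Multiset.mem_add.1 hi with hi | hi
    · rw [Multiset.mem_singleton.1 hi]
      exact Nat.mul_pos hp.pos (μ.parts_pos (Multiset.count_pos.1 (hp.pos.trans_le hk)))
    · exact μ.parts_pos (ht ▸ Multiset.mem_add.2 (Or.inr hi))
  obtain ⟨ν, hν⟩ : ∃ ν : n.Partition, ν.parts = {p * k} + t :=
    ⟨⟨{p * k} + t, fun {i} => hpos i, by rw [← μ.parts_sum, ht]; simp⟩, rfl⟩
  refine ⟨ν, ?_, ?_⟩
  · rw [hν, ht, Multiset.card_add, Multiset.card_add, Multiset.card_replicate,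
      Multiset.card_singleton]
    exact Nat.add_lt_add_right hp.one_lt _
  · have hord : ordCompl[p] (p * k) = ordCompl[p] k := by
      simpa using Nat.ordCompl_self_pow_mul k 1 hp
    rw [hν, ht, primeToLengths_add, primeToLengths_add, primeToLengths_replicate,
      ← Multiset.replicate_one, primeToLengths_replicate, one_mul, hord]

theorem exists_isRegular (hp : p.Prime ∨ p = 0) (μ : n.Partition) :
    ∃ ν : n.Partition, IsRegular p ν ∧ primeToLengths p ν.parts = primeToLengths p μ.parts := by
  rcases hp with hp | rfl
  · induction hN : μ.parts.card using Nat.strong_induction_on generalizing μ with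
    | _ N ih =>
      by_cases hμ : IsRegular p μ
      · exact ⟨μ, hμ, rfl⟩
      · obtain ⟨ν, hcard, hν⟩ := exists_card_parts_lt_of_not_isRegular hp hμ
        obtain ⟨ξ, hreg, hξ⟩ := ih _ (hN ▸ hcard) ν rfl
        exact ⟨ξ, hreg, hξ.trans hν⟩
  · exact ⟨μ, fun h => absurd rfl h, rfl⟩

/-- The elements of `S` are the place values of a mixed radix system. -/
theorem eq_of_sum_mul_eq {S : Finset ℕ} (h0 : 0 ∉ S)
    (hS : ∀ e ∈ S, ∀ k ∈ S, e < k → p * e ∣ k) {a b : ℕ → ℕ} (ha : ∀ k ∈ S, a k < p)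
    (hb : ∀ k ∈ S, b k < p) (hab : ∑ k ∈ S, a k * k = ∑ k ∈ S, b k * k) :
    ∀ k ∈ S, a k = b k := by
  induction S using Finset.induction_on_min with
  | empty => simp
  | insert e T he ih =>
    have heT : e ∉ T := fun h => (he e h).false
    have hdvd (c : ℕ → ℕ) : p * e ∣ ∑ k ∈ T, c k * k := Finset.dvd_sum fun k hk =>
      (hS e (Finset.mem_insert_self e T) k (Finset.mem_insert_of_mem hk) (he k hk)).mul_left _
    rw [Finset.sum_insert heT, Finset.sum_insert heT] at hab
    have hmod : a e * e ≡ b e * e [MOD p * e] :=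
      Nat.ModEq.add_right_cancel ((hdvd a).modEq_zero_nat.trans (hdvd b).modEq_zero_nat.symm)
        (hab ▸ Nat.ModEq.rfl)
    have hae : a e = b e := by
      refine Nat.ModEq.eq_of_lt_of_lt (hmod.mul_right_cancel' ?_)
        (ha e (Finset.mem_insert_self e T)) (hb e (Finset.mem_insert_self e T))
      rintro rfl
      exact h0 (Finset.mem_insert_self 0 T)
    rw [hae, Nat.add_left_cancel_iff] at hab
    rw [Finset.forall_mem_insert] at ha hb ⊢
    exact ⟨hae, ih (fun h => h0 (Finset.mem_insert_of_mem h)) (fun i hi j hj =>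
      hS i (Finset.mem_insert_of_mem hi) j (Finset.mem_insert_of_mem hj)) ha.2 hb.2 hab⟩

theorem mul_dvd_of_ordCompl_eq (hp : p.Prime) {e k : ℕ} (h : ordCompl[p] e = ordCompl[p] k)
    (hek : e < k) : p * e ∣ k := by
  have hfact : e.factorization p < k.factorization p := by
    by_contra! hle
    refine hek.not_ge ?_
    rw [← Nat.ordProj_mul_ordCompl_eq_self k p, ← h]
    conv_rhs => rw [← Nat.ordProj_mul_ordCompl_eq_self e p]
    gcongr
    exact hp.pos
  calc p * e = p ^ (e.factorization p + 1) * ordCompl[p] k := by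
        rw [pow_succ', mul_assoc, ← h, Nat.ordProj_mul_ordCompl_eq_self]
    _ ∣ p ^ k.factorization p * ordCompl[p] k := by gcongr; exact hfact
    _ = k := Nat.ordProj_mul_ordCompl_eq_self k p

theorem eq_of_primeToLengths_eq (hp : p.Prime ∨ p = 0) (hμ : IsRegular p μ) (hν : IsRegular p ν)
    (h : primeToLengths p μ.parts = primeToLengths p ν.parts) : μ = ν := by
  refine Nat.Partition.ext ?_
  rcases hp with hp | rfl
  · let S := μ.parts.toFinset ∪ ν.parts.toFinset
    have h0 : 0 ∉ S := by
      simp [S, zero_notMem_parts]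
    ext k
    by_cases hk : k ∈ S
    · refine eq_of_sum_mul_eq (S := S.filter fun i => ordCompl[p] i = ordCompl[p] k) (p := p)
        ?_ ?_ (fun i _ => hμ hp.ne_zero i) (fun i _ => hν hp.ne_zero i) ?_ k ?_
      · exact fun h => h0 (Finset.mem_filter.1 h).1
      · intro e he j hj
        exact mul_dvd_of_ordCompl_eq hp
          ((Finset.mem_filter.1 he).2.trans (Finset.mem_filter.1 hj).2.symm)
      · rw [← count_primeToLengths Finset.subset_union_left, h,
          count_primeToLengths Finset.subset_union_right]
      · exact Finset.mem_filter.2 ⟨hk, rfl⟩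
    · rw [Finset.mem_union, Multiset.mem_toFinset, Multiset.mem_toFinset, not_or] at hk
      rw [Multiset.count_eq_zero.2 hk.1, Multiset.count_eq_zero.2 hk.2]
  · exact eq_of_pointLengths_eq (zero_notMem_parts μ) (zero_notMem_parts ν)
      (by rwa [← primeToLengths_zero, ← primeToLengths_zero])

end PEquivalence

/-! ### The map on vertices -/

section VertexMap

variable {F : Type u} [Field F] {p m s : ℕ} [CharP F p]

/-- The vertex `μ^{#s}` of the Ext quiver of `D_{m+s}(F)`: the `p`-regular partition that is
`p`-equivalent to `addPart μ s`. -/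
noncomputable def sharp (s : ℕ) (μ : ExtQuiver F p m) : ExtQuiver F p (m + s) :=
  ⟨_, (exists_isRegular (CharP.char_is_prime_or_zero F p) (addPart μ.1 s)).choose_spec.1⟩

theorem primeToLengths_sharp (μ : ExtQuiver F p m) :
    primeToLengths p (sharp s μ).1.parts = primeToLengths p (addPart μ.1 s).parts :=
  (exists_isRegular (CharP.char_is_prime_or_zero F p) (addPart μ.1 s)).choose_spec.2

theorem ExtQuiver.ext_of_primeToLengths {μ ν : ExtQuiver F p m}
    (h : primeToLengths p μ.1.parts = primeToLengths p ν.1.parts) : μ = ν :=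
  Subtype.ext (eq_of_primeToLengths_eq (CharP.char_is_prime_or_zero F p) μ.2 ν.2 h)

theorem pEquivalent_addPart_iff (μ : ExtQuiver F p m) (ν : ExtQuiver F p (m + s)) :
    PEquivalent p ν.1 (addPart μ.1 s) ↔ ν = sharp s μ := by
  rw [pEquivalent_iff (CharP.char_is_prime_or_zero F p), ← primeToLengths_sharp]
  exact ⟨ExtQuiver.ext_of_primeToLengths, fun h => h ▸ rfl⟩

theorem sharp_injective (hs : 1 ≤ s) :
    Function.Injective (sharp s : ExtQuiver F p m → ExtQuiver F p (m + s)) := by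
  intro μ ν h
  have hlen : primeToLengths p (addPart μ.1 s).parts = primeToLengths p (addPart ν.1 s).parts := by
    rw [← primeToLengths_sharp, h, primeToLengths_sharp]
  rw [primeToLengths_parts_addPart hs, primeToLengths_parts_addPart hs, add_right_inj] at hlen
  exact ExtQuiver.ext_of_primeToLengths hlen

theorem simpleCharacter_sharp (hs : 1 ≤ s) (μ : ExtQuiver F p m) :
    simpleCharacter F (sharp s μ).1 = (simpleCharacter F μ.1).comp (descentRestrict F) := by
  rw [← simpleCharacter_addPart hs]
  exact simpleCharacter_eq_of_pEquivalent F ((pEquivalent_addPart_iff μ _).2 rfl)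

theorem numArrows_le_numArrows_sharp (hs : 1 ≤ s) (μ ν : ExtQuiver F p m) :
    numArrows F μ.1 ν.1 ≤ numArrows F (sharp s μ).1 (sharp s ν).1 :=
  numArrows_le_of_surjective (descentRestrict_surjective F) (simpleCharacter_sharp hs μ)
    (simpleCharacter_sharp hs ν)

end VertexMap

end Descent

theorem theorem4p7 {F : Type*} [Field F] (p : ℕ) [CharP F p] (m s : ℕ) (hs : 1 ≤ s) :
    ∃ φ : Descent.ExtQuiver F p m ⥤q Descent.ExtQuiver F p (m + s),
      Function.Injective φ.obj ∧
      (∀ lam mu : Descent.ExtQuiver F p m,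
        Function.Injective (φ.map : (lam ⟶ mu) → (φ.obj lam ⟶ φ.obj mu))) ∧
      ∀ (mu : Descent.ExtQuiver F p m) (lam : Descent.ExtQuiver F p (m + s)),
        Descent.PEquivalent p lam.1 (Descent.addPart mu.1 s) ↔ lam = φ.obj mu := by
  have hle := Descent.numArrows_le_numArrows_sharp (F := F) (p := p) (m := m) hs
  exact ⟨⟨Descent.sharp s, fun {lam mu} a => Fin.castLE (hle lam mu) a⟩,
    Descent.sharp_injective hs, fun lam mu => Fin.castLE_injective (hle lam mu),
    Descent.pEquivalent_addPart_iff⟩
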